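/- Let $\mathbb D=\{z\in\mathbb C:|z|<1\}$ and let $k\in[0,1]$, $p\in(0,2]$, $m\in\mathbb N=\{1,2,\dots\}$. Let $\mathcal H_k$ be the set of harmonic mappings $f=h+\overline g$ in $\mathbb D$ with $h(z)=\sum_{n\ge0}a_nz^n$ and $g(z)=\sum_{n\ge1}b_nz^n$ analytic in $\mathbb D$ (so $g(0)=0$), $|h|\le1$ in $\mathbb D$ and $|g'|\le k|h'|$ in $\mathbb D$. All mappings below are assumed to have $h$ not identically constant. For $r\in[0,1)$ put $\|h_0\|_r^2=\sum_{n\ge1}|a_n|^2r^{2n}$ (where $h_0=h-h(0)$), $\|g\|_r^2=\sum_{n\ge1}|b_n|^2r^{2n}$, $c(0)=0$, $c(k)=1/k$ for $k\in(0,1]$, $$E_f(k,r)=\sum_{n=1}^\infty|a_n|r^n+\sum_{n=1}^\infty|b_n|r^n+\frac1{1+|a_0|}\left(\frac{1+|a_0|r}{1-r}\right)\left(\|h_0\|_r^2+c(k)\|g\|_r^2\right),$$ $$F_f^p(z)=|h(z^m)|^p+E_f(k,|z|)\qquad(z\in\mathbb D).$$ Then the equation $$2(1+k)r(1+r^m)-p(1-r)(1-r^m)=0$$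 has a unique root $r^p_{m,k}$ in $(0,1)$, and the following hold. (i) Let $f=h+\overline g\in\mathcal H_k$ and let $q$ be the order of the zero of $h_0=h-h(0)$ at $0$. If $k=0$, or if $k\in(0,1]$ and $|b_q|\le 1/(2k|a_q|)$, then $F_f^p(z)\le1$ for all $|z|\le r^p_{m,k}$. (ii) Suppose that $k=0$, or $k=1$, or $p\in(0,1]$, or that $k\in(0,1)$, $p\in(1,2]$ and $r^p_{m,k}\le1/3$. Then $F_f^p(z)\le1$ for all $f\in\mathcal H_k$ and all $|z|\le r^p_{m,k}$ (without any condition on $b_q$), and the constant $r^p_{m,k}$ cannot be improved: for every $r\in(r^p_{m,k},1)$ there are $f\in\mathcal H_k$ and $z$ with $|z|=r$ and $F_f^p(z)>1$. -/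

import Mathlib

open Metric Set

/-- The `n`-th Taylor coefficient of `f` at the origin. -/
noncomputable def taylorCoeff (f : ℂ → ℂ) (n : ℕ) : ℂ :=
  iteratedDeriv n f 0 / (n.factorial : ℂ)

/-- The class `𝓑` of analytic functions on the open unit disk that are bounded by `1` there. -/
structure MemB (h : ℂ → ℂ) : Prop where
  analytic : DifferentiableOn ℂ h (ball 0 1)
  bounded : ∀ z ∈ ball (0 : ℂ) 1, ‖h z‖ ≤ 1

/-- The class `𝓗_k` of harmonic mappings `f = h + conj g` of the open unit disk. The mapping is
represented by the pair `(h, g)`, which it determines because `g 0 = 0`. -/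
structure MemHk (k : ℝ) (h g : ℂ → ℂ) : Prop where
  memB : MemB h
  analytic : DifferentiableOn ℂ g (ball 0 1)
  map_zero : g 0 = 0
  deriv_le : ∀ z ∈ ball (0 : ℂ) 1, ‖deriv g z‖ ≤ k * ‖deriv h z‖

/-- `h` is not identically constant in the open unit disk. -/
def NonconstantOnDisk (h : ℂ → ℂ) : Prop :=
  ¬ ∃ c : ℂ, ∀ z ∈ ball (0 : ℂ) 1, h z = c

/-- `∑_{n ≥ 1} |a_n| r^n`, where `a_n` are the Taylor coefficients of `f` at the origin. -/
noncomputable def majorant (f : ℂ → ℂ) (r : ℝ) : ℝ :=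
  ∑' n : ℕ, ‖taylorCoeff f (n + 1)‖ * r ^ (n + 1)

/-- `∑_{n ≥ 1} |a_n|² r^{2n}`; for `f` this is `‖f₀‖_r²`, with `f₀ = f - f 0`. -/
noncomputable def normSqR (f : ℂ → ℂ) (r : ℝ) : ℝ :=
  ∑' n : ℕ, ‖taylorCoeff f (n + 1)‖ ^ 2 * r ^ (2 * (n + 1))

/-- `c(k) = 1/k` for `k ≠ 0`, and `c(0) = 0`. -/
noncomputable def cFun (k : ℝ) : ℝ := if k = 0 then 0 else 1 / k

/-- The quantity `E_f(k, r)` of `f = h + conj g`. -/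
noncomputable def EFun (k : ℝ) (h g : ℂ → ℂ) (r : ℝ) : ℝ :=
  majorant h r + majorant g r
    + 1 / (1 + ‖h 0‖) * ((1 + ‖h 0‖ * r) / (1 - r)) * (normSqR h r + cFun k * normSqR g r)

/-- The quantity `F_f^p(z) = |h(z^m)|^p + E_f(k, |z|)` of `f = h + conj g`. -/
noncomputable def FFun (m : ℕ) (k p : ℝ) (h g : ℂ → ℂ) (z : ℂ) : ℝ :=
  ‖h (z ^ m)‖ ^ p + EFun k h g ‖z‖

/-- `λ_{m,k}^p(r) = 2(1+k) r (1+r^m) - p (1-r)(1-r^m)`. -/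
noncomputable def lam (m : ℕ) (k p r : ℝ) : ℝ :=
  2 * (1 + k) * r * (1 + r ^ m) - p * (1 - r) * (1 - r ^ m)

/-- The series in `majorant` converges for every function analytic in the disk. -/
theorem summable_majorant {f : ℂ → ℂ} (hf : DifferentiableOn ℂ f (ball 0 1)) {r : ℝ}
    (h0 : 0 ≤ r) (h1 : r < 1) :
    Summable (fun n : ℕ => ‖taylorCoeff f (n + 1)‖ * r ^ (n + 1)) := by
  have hs : Summable (fun n : ℕ => ‖taylorCoeff f n‖ * r ^ n) := by
    have hr : ((r : ℂ)) ∈ ball (0 : ℂ) 1 := by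
      simpa [abs_of_nonneg h0] using h1
    have := (Complex.hasSum_taylorSeries_on_ball hf hr).summable.norm
    refine this.congr fun n => ?_
    simp [taylorCoeff, abs_of_nonneg h0, div_eq_inv_mul]
    ring
  exact (summable_nat_add_iff 1).2 hs

/-- The series in `normSqR` converges for every function analytic in the disk. -/
theorem summable_normSqR {f : ℂ → ℂ} (hf : DifferentiableOn ℂ f (ball 0 1)) {r : ℝ}
    (h0 : 0 ≤ r) (h1 : r < 1) :
    Summable (fun n : ℕ => ‖taylorCoeff f (n + 1)‖ ^ 2 * r ^ (2 * (n + 1))) := by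
  have hs := summable_majorant hf h0 h1
  have hn : ∀ n : ℕ, 0 ≤ ‖taylorCoeff f (n + 1)‖ * r ^ (n + 1) := fun n => by positivity
  refine Summable.of_norm_bounded_eventually_nat hs ?_
  filter_upwards [hs.tendsto_atTop_zero.eventually_lt_const one_pos] with n hlt
  have e : ‖taylorCoeff f (n + 1)‖ ^ 2 * r ^ (2 * (n + 1))
      = (‖taylorCoeff f (n + 1)‖ * r ^ (n + 1)) ^ 2 := by ring
  rw [e, Real.norm_of_nonneg (sq_nonneg _)]
  nlinarith [hn n]

/-! Everything rests on one bound: E_f(k, r) ≤ (1 + k)(1 - |a₀|²) r/(1 - r) for 0 ≤ r ≤ 1/2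
(`MemHk.EFun_le`). Put a = |a₀|, ρ = |z|^m, t = |h(z^m)|. The growth bound t ≤ (a + ρ)/(1 + aρ) and
Bernoulli's inequality t^p ≤ 1 - (p/2)(1 - t²) give F - 1 ≤ (1 - a²)[(1 + k) r/(1 - r) - (p/2)(1 -
ρ)/(1 + ρ)], and the bracket has the sign of `lam`. Since `lam` is strictly increasing on [0, 1],
its sign is governed by its root, and `lam` ≤ 0 forces r ≤ 1/2.

The contribution of h to E_f is handled by Carlson's coefficient inequalities. These come from
testing the contractive Toeplitz matrices of h on well chosen vectors, and they telescope into the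
refined Bohr inequality `MemB.majorant_add_le`.

For k > 0 write g = kG. The weight 1/k makes the contribution of g equal to k times the same
expression in G, where G' = ωh' with |ω| ≤ 1. Since G need not lie in 𝓑, Carlson does not apply to
it. Instead G is compared with h: the Toeplitz contraction for ω and Abel summation compare square
sums, and |ω_n| ≤ 1 - |ω(0)|² compares majorants. The bound for G then follows in four cases
(`HasDilatation.majorant_add_le`).

For sharpness, take h(z) = (a + z)/(1 + az) and g = k(h - h(0)) with a → 1: to first order in 1 - a,
the sign of F - 1 is that of `lam`. -/

/-! ### Parseval on the unit circle. -/

/-- The average of `‖p‖²` over the unit circle for a polynomial given by its coefficients. -/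
theorem circleAverage_sq_norm_sum (c : ℕ → ℂ) (N : ℕ) :
    Real.circleAverage (fun z => ‖∑ n ∈ Finset.range N, c n * z ^ n‖ ^ 2) 0 1
      = ∑ n ∈ Finset.range N, ‖c n‖ ^ 2 := by
  set p : Polynomial ℂ := ∑ n ∈ Finset.range N, Polynomial.monomial n (c n) with hp
  have hcoeff : ∀ n, p.coeff n = if n < N then c n else 0 := by
    intro n
    simp [hp, Polynomial.coeff_monomial]
  have heval : ∀ z, p.eval z = ∑ n ∈ Finset.range N, c n * z ^ n := by
    intro z
    simp [hp, Polynomial.eval_finsetSum, Polynomial.eval_monomial]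
  have h := Polynomial.sum_sq_norm_coeff_eq_circleAverage p
  simp only [heval] at h
  rw [← h]
  have hsub : p.support ⊆ Finset.range N := by
    intro n hn
    by_contra hlt
    simp [hcoeff, Finset.mem_range.not.1 hlt] at hn
  rw [Finset.sum_subset hsub]
  · exact Finset.sum_congr rfl fun n hn => by simp [hcoeff, Finset.mem_range.1 hn]
  · intro n _ hn
    simp [Polynomial.notMem_support_iff.1 hn]

/-- If one absolutely convergent power series dominates another on the unit circle, then so does
its `ℓ²` norm of coefficients. -/
theorem sum_sq_norm_le_of_norm_le {c d : ℕ → ℂ} (hc : Summable fun n => ‖c n‖)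
    (hd : Summable fun n => ‖d n‖)
    (hle : ∀ z : ℂ, ‖z‖ = 1 → ‖∑' n, c n * z ^ n‖ ≤ ‖∑' n, d n * z ^ n‖)
    (N₀ : ℕ) {S : ℝ} (hS : ∀ N, ∑ n ∈ Finset.range N, ‖d n‖ ^ 2 ≤ S) :
    ∑ n ∈ Finset.range N₀, ‖c n‖ ^ 2 ≤ S := by
  have key : ∀ e : ℕ → ℂ, (Summable fun n => ‖e n‖) → ∀ z : ℂ, ‖z‖ = 1 → ∀ N,
      ‖∑ n ∈ Finset.range N, e n * z ^ n - ∑' n, e n * z ^ n‖ ≤ ∑' n, ‖e (n + N)‖ := by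
    intro e he z hz N
    have h1 : Summable fun n => e n * z ^ n := by
      refine Summable.of_norm ?_
      simpa [hz] using he
    rw [← h1.sum_add_tsum_nat_add N, sub_add_cancel_left, norm_neg]
    refine (norm_tsum_le_tsum_norm ?_).trans_eq ?_
    · simpa [hz] using (summable_nat_add_iff N).2 he
    · simp [hz]
  set K := ∑' n, ‖d n‖
  -- The combined tails: on |z| = 1 truncating both series costs at most ε N, so the squares compare
  -- up to 2Kε + ε², which tends to 0. Thus Parseval is needed for polynomials only.
  set ε : ℕ → ℝ := fun N => ∑' n, ‖c (n + N)‖ + ∑' n, ‖d (n + N)‖ with hε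
  have hε0 : ∀ N, 0 ≤ ε N := fun N => by positivity
  have hεt : Filter.Tendsto ε Filter.atTop (nhds 0) := by
    simpa using (tendsto_sum_nat_add fun n => ‖c n‖).add (tendsto_sum_nat_add fun n => ‖d n‖)
  have hpt : ∀ N, ∀ z : ℂ, ‖z‖ = 1 → ‖∑ n ∈ Finset.range N, c n * z ^ n‖ ^ 2
      ≤ ‖∑ n ∈ Finset.range N, d n * z ^ n‖ ^ 2 + (2 * K * ε N + ε N ^ 2) := by
    intro N z hz
    have h1 := key c hc z hz N
    have h2 := key d hd z hz N
    have h3 := hle z hz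
    have h4 : ‖∑ n ∈ Finset.range N, c n * z ^ n‖ ≤ ‖∑' n, c n * z ^ n‖ + ∑' n, ‖c (n + N)‖ := by
      have := norm_sub_norm_le (∑ n ∈ Finset.range N, c n * z ^ n) (∑' n, c n * z ^ n)
      linarith
    have h5 : ‖∑' n, d n * z ^ n‖ ≤ ‖∑ n ∈ Finset.range N, d n * z ^ n‖ + ∑' n, ‖d (n + N)‖ := by
      have := norm_sub_norm_le (∑' n, d n * z ^ n) (∑ n ∈ Finset.range N, d n * z ^ n)
      rw [norm_sub_rev] at this
      linarith
    have h6 : ‖∑ n ∈ Finset.range N, d n * z ^ n‖ ≤ K := by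
      refine (norm_sum_le _ _).trans ?_
      simp only [norm_mul, norm_pow, hz, one_pow, mul_one]
      exact hd.sum_le_tsum _ fun _ _ => norm_nonneg _
    have h7 : ‖∑ n ∈ Finset.range N, c n * z ^ n‖
        ≤ ‖∑ n ∈ Finset.range N, d n * z ^ n‖ + ε N := by simp only [hε]; linarith
    have h8 := pow_le_pow_left₀ (norm_nonneg _) h7 2
    nlinarith [hε0 N]
  have hint : ∀ (e : ℕ → ℂ) N, CircleIntegrable
      (fun z => ‖∑ n ∈ Finset.range N, e n * z ^ n‖ ^ 2) 0 1 := fun e N =>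
    ContinuousOn.circleIntegrable zero_le_one (by fun_prop)
  have hav : ∀ N, ∑ n ∈ Finset.range N, ‖c n‖ ^ 2 ≤ S + (2 * K * ε N + ε N ^ 2) := by
    intro N
    refine le_trans ?_ (add_le_add_left (hS N) _)
    rw [← circleAverage_sq_norm_sum, ← circleAverage_sq_norm_sum]
    have hconst : CircleIntegrable (fun _ : ℂ => 2 * K * ε N + ε N ^ 2) 0 1 :=
      circleIntegrable_const _ _ _
    have hadd := Real.circleAverage_fun_add (hint d N) hconst
    rw [Real.circleAverage_const] at hadd
    rw [← hadd]
    refine Real.circleAverage_mono (hint c N) ((hint d N).add hconst) fun z hz => ?_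
    exact hpt N z (by simpa using hz)
  have hlim : Filter.Tendsto (fun N => S + (2 * K * ε N + ε N ^ 2)) Filter.atTop (nhds S) := by
    have := ((hεt.const_mul (2 * K)).add (hεt.pow 2)).const_add S
    simpa using this
  refine ge_of_tendsto hlim ?_
  filter_upwards [Filter.eventually_ge_atTop N₀] with N hN
  refine le_trans ?_ (hav N)
  exact Finset.sum_le_sum_of_subset_of_nonneg (Finset.range_mono hN) fun _ _ _ => by positivity

/-! ### Taylor series and the Toeplitz contraction. -/

theorem hasSum_taylorCoeff {f : ℂ → ℂ} (hf : DifferentiableOn ℂ f (ball 0 1)) {z : ℂ}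
    (hz : ‖z‖ < 1) : HasSum (fun n => taylorCoeff f n * z ^ n) (f z) := by
  have := Complex.hasSum_taylorSeries_on_ball hf (mem_ball_zero_iff.2 hz)
  refine this.congr_fun fun n => ?_
  simp [taylorCoeff, div_eq_inv_mul]
  ring

theorem summable_norm_taylorCoeff {f : ℂ → ℂ} (hf : DifferentiableOn ℂ f (ball 0 1)) {r : ℝ}
    (h0 : 0 ≤ r) (h1 : r < 1) : Summable fun n => ‖taylorCoeff f n‖ * r ^ n :=
  (summable_nat_add_iff 1).1 (summable_majorant hf h0 h1)

theorem taylorCoeff_zero (f : ℂ → ℂ) : taylorCoeff f 0 = f 0 := by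
  simp [taylorCoeff]

/-- The truncated lower triangular Toeplitz matrices of a function in `𝓑` are contractions. -/
theorem MemB.sum_sq_norm_conv_le {ω : ℂ → ℂ} (hω : MemB ω) (p : ℕ → ℂ) (N : ℕ) :
    ∑ n ∈ Finset.range N, ‖∑ j ∈ Finset.range (n + 1), taylorCoeff ω (n - j) * p j‖ ^ 2
      ≤ ∑ n ∈ Finset.range N, ‖p n‖ ^ 2 := by
  set P : ℕ → ℂ := fun n => if n < N then p n else 0 with hP
  -- Multiplication by ω does not increase the modulus of a polynomial on |z| = r. Working at r < 1
  -- makes the series of ω absolutely convergent on the circle; r → 1 comes at the end.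
  have hr : ∀ r : ℝ, r ∈ Ioo (0 : ℝ) 1 →
      ∑ n ∈ Finset.range N, ‖∑ j ∈ Finset.range (n + 1), taylorCoeff ω (n - j) * p j‖ ^ 2
        * r ^ (2 * n) ≤ ∑ n ∈ Finset.range N, ‖p n‖ ^ 2 := by
    rintro r ⟨hr0, hr1⟩
    set a : ℕ → ℂ := fun n => taylorCoeff ω n * (r : ℂ) ^ n with ha
    set b : ℕ → ℂ := fun n => P n * (r : ℂ) ^ n with hb
    have hPsupp : ∀ n, n ∉ Finset.range N → P n = 0 := fun n hn => by
      simp [hP, Finset.mem_range.not.1 hn]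
    have hsa : Summable fun n => ‖a n‖ := by
      simpa [ha, abs_of_pos hr0] using summable_norm_taylorCoeff hω.analytic hr0.le hr1
    have hsb : Summable fun n => ‖b n‖ :=
      summable_of_ne_finset_zero (s := Finset.range N) fun n hn => by simp [hb, hPsupp n hn]
    have hconv := summable_norm_sum_mul_range_of_summable_norm hsb hsa
    refine le_trans (le_of_eq ?_) (sum_sq_norm_le_of_norm_le hconv hsb ?_ N
      (S := ∑ n ∈ Finset.range N, ‖p n‖ ^ 2) ?_)
    · refine Finset.sum_congr rfl fun n hn => ?_
      have : ∑ k ∈ Finset.range (n + 1), b k * a (n - k)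
          = (∑ j ∈ Finset.range (n + 1), taylorCoeff ω (n - j) * p j) * (r : ℂ) ^ n := by
        rw [Finset.sum_mul]
        refine Finset.sum_congr rfl fun j hj => ?_
        have hj' : j ≤ n := Nat.lt_succ_iff.1 (Finset.mem_range.1 hj)
        have hjN : j < N := hj'.trans_lt (Finset.mem_range.1 hn)
        have : (r : ℂ) ^ n = (r : ℂ) ^ j * (r : ℂ) ^ (n - j) := by
          rw [← pow_add, Nat.add_sub_cancel' hj']
        simp only [ha, hb, hP, hjN, if_true, this]
        ring
      rw [this, norm_mul, mul_pow, norm_pow, Complex.norm_real, Real.norm_of_nonneg hr0.le,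
        ← pow_mul, mul_comm n 2]
    · intro z hz
      have hz' : ∀ e : ℕ → ℂ, (Summable fun n => ‖e n‖) → Summable fun n => ‖e n * z ^ n‖ := by
        intro e he
        simpa [hz] using he
      have hprod := tsum_mul_tsum_eq_tsum_sum_range_of_summable_norm (hz' b hsb) (hz' a hsa)
      have heq : ∀ n, (∑ k ∈ Finset.range (n + 1), b k * a (n - k)) * z ^ n
          = ∑ k ∈ Finset.range (n + 1), b k * z ^ k * (a (n - k) * z ^ (n - k)) := by
        intro n
        rw [Finset.sum_mul]
        refine Finset.sum_congr rfl fun j hj => ?_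
        have : z ^ n = z ^ j * z ^ (n - j) := by
          rw [← pow_add, Nat.add_sub_cancel' (Nat.lt_succ_iff.1 (Finset.mem_range.1 hj))]
        rw [this]; ring
      simp only [heq]
      rw [← hprod, norm_mul]
      have hval : ∑' n, a n * z ^ n = ω (r * z) := by
        rw [← (hasSum_taylorCoeff hω.analytic (z := r * z)
          (by simpa [hz, abs_of_pos hr0] using hr1)).tsum_eq]
        exact tsum_congr fun n => by simp only [ha, mul_pow]; ring
      have hbd : ‖ω (r * z)‖ ≤ 1 :=
        hω.bounded _ (by simpa [hz, abs_of_pos hr0] using hr1)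
      rw [hval]
      exact mul_le_of_le_one_right (norm_nonneg _) hbd
    · intro M
      calc ∑ n ∈ Finset.range M, ‖b n‖ ^ 2
          ≤ ∑ n ∈ Finset.range (max M N), ‖b n‖ ^ 2 :=
            Finset.sum_le_sum_of_subset_of_nonneg (Finset.range_mono (le_max_left _ _))
              fun _ _ _ => by positivity
        _ = ∑ n ∈ Finset.range N, ‖b n‖ ^ 2 :=
            (Finset.sum_subset (Finset.range_mono (le_max_right _ _)) fun n _ hn => by
              simp [hb, hPsupp n hn]).symm
        _ ≤ ∑ n ∈ Finset.range N, ‖p n‖ ^ 2 := by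
            refine Finset.sum_le_sum fun n hn => ?_
            have : ‖b n‖ ≤ ‖p n‖ := by
              simp only [hb, hP, Finset.mem_range.1 hn, if_true, norm_mul, norm_pow,
                Complex.norm_real, Real.norm_of_nonneg hr0.le]
              exact mul_le_of_le_one_right (norm_nonneg _) (pow_le_one₀ hr0.le hr1.le)
            exact pow_le_pow_left₀ (norm_nonneg _) this 2
  have hcont : Filter.Tendsto (fun r : ℝ => ∑ n ∈ Finset.range N,
      ‖∑ j ∈ Finset.range (n + 1), taylorCoeff ω (n - j) * p j‖ ^ 2 * r ^ (2 * n))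
      (nhdsWithin 1 (Iio 1)) (nhds (∑ n ∈ Finset.range N,
        ‖∑ j ∈ Finset.range (n + 1), taylorCoeff ω (n - j) * p j‖ ^ 2)) := by
    refine tendsto_nhdsWithin_of_tendsto_nhds ?_
    have : Continuous (fun r : ℝ => ∑ n ∈ Finset.range N,
      ‖∑ j ∈ Finset.range (n + 1), taylorCoeff ω (n - j) * p j‖ ^ 2 * r ^ (2 * n)) := by fun_prop
    simpa using this.tendsto 1
  refine le_of_tendsto hcont ?_
  filter_upwards [Ioo_mem_nhdsLT (zero_lt_one' ℝ)] with r hr'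
  exact hr r hr'

/-! ### Schwarz–Pick and growth in the class 𝓑. -/

theorem MemB.norm_zero_le {h : ℂ → ℂ} (hh : MemB h) : ‖h 0‖ ≤ 1 := hh.bounded 0 (by simp)

theorem MemB.norm_zero_lt {h : ℂ → ℂ} (hh : MemB h) (hn : NonconstantOnDisk h) : ‖h 0‖ < 1 := by
  refine lt_of_le_of_ne hh.norm_zero_le fun h1 => hn ⟨h 0, ?_⟩
  refine Complex.eqOn_of_isPreconnected_of_isMaxOn_norm (convex_ball 0 1).isPreconnected isOpen_ball
    hh.analytic (mem_ball_self one_pos) ?_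
  intro z hz
  simpa [h1] using hh.bounded z hz

/-- Partial sums of `|aₙ|²` are at most `1`. -/
theorem MemB.sum_sq_norm_le_one {h : ℂ → ℂ} (hh : MemB h) (N : ℕ) :
    ∑ n ∈ Finset.range N, ‖taylorCoeff h n‖ ^ 2 ≤ 1 := by
  have := hh.sum_sq_norm_conv_le (fun j => if j = 0 then 1 else 0) N
  refine le_trans (le_of_eq ?_) (this.trans ?_)
  · refine Finset.sum_congr rfl fun n _ => ?_
    simp
  · rcases N with _ | N
    · simp
    · rw [Finset.sum_range_succ']
      simp

/-- The Schwarz–Pick inequality at the origin. -/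
theorem MemB.norm_sub_le {h : ℂ → ℂ} (hh : MemB h) (h1 : ‖h 0‖ < 1) {z : ℂ} (hz : ‖z‖ < 1) :
    ‖h z - h 0‖ ≤ ‖z‖ * ‖1 - (starRingEnd ℂ) (h 0) * h z‖ := by
  have hne : ∀ w ∈ ball (0 : ℂ) 1, 1 - (starRingEnd ℂ) (h 0) * h w ≠ 0 := by
    intro w hw h0
    have h2 : ‖(starRingEnd ℂ) (h 0) * h w‖ < 1 := by
      rw [norm_mul, RCLike.norm_conj]
      exact mul_lt_one_of_nonneg_of_lt_one_left (norm_nonneg _) h1 (hh.bounded w hw)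
    rw [← sub_eq_zero.1 h0] at h2
    simp at h2
  set φ : ℂ → ℂ := fun w => (h w - h 0) / (1 - (starRingEnd ℂ) (h 0) * h w) with hφ
  have hd : DifferentiableOn ℂ φ (ball 0 1) :=
    (hh.analytic.sub_const _).div ((differentiableOn_const _).sub (hh.analytic.const_mul _)) hne
  have hm : MapsTo φ (ball 0 1) (closedBall 0 1) := by
    intro w hw
    rw [mem_closedBall_zero_iff, hφ]
    simp only [norm_div]
    refine div_le_one_of_le₀ ?_ (norm_nonneg _)
    have hb := hh.bounded w hw
    have hid : ‖1 - (starRingEnd ℂ) (h 0) * h w‖ ^ 2 - ‖h w - h 0‖ ^ 2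
        = (1 - ‖h 0‖ ^ 2) * (1 - ‖h w‖ ^ 2) := by
      simp only [Complex.sq_norm, Complex.normSq_apply]
      simp
      ring
    have h3 : 0 ≤ (1 - ‖h 0‖ ^ 2) * (1 - ‖h w‖ ^ 2) := by
      apply mul_nonneg <;> nlinarith [norm_nonneg (h 0), norm_nonneg (h w)]
    exact le_of_sq_le_sq (by linarith) (norm_nonneg _)
  have := Complex.norm_le_norm_of_mapsTo_ball hd hm (by simp [hφ]) hz
  rw [hφ] at this
  simp only [norm_div] at this
  rwa [div_le_iff₀ (norm_pos_iff.2 (hne z (by simpa using hz)))] at this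

/-- The sharp growth bound for functions of the class `𝓑`. -/
theorem MemB.norm_le_div {h : ℂ → ℂ} (hh : MemB h) (h1 : ‖h 0‖ < 1) {z : ℂ} (hz : ‖z‖ < 1) :
    ‖h z‖ ≤ (‖h 0‖ + ‖z‖) / (1 + ‖h 0‖ * ‖z‖) := by
  have hsp := hh.norm_sub_le h1 hz
  have hb := hh.bounded z (by simpa using hz)
  have hid : ‖1 - (starRingEnd ℂ) (h 0) * h z‖ ^ 2 - ‖h z - h 0‖ ^ 2
      = (1 - ‖h 0‖ ^ 2) * (1 - ‖h z‖ ^ 2) := by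
    simp only [Complex.sq_norm, Complex.normSq_apply]
    simp
    ring
  have hlow : 1 - ‖h 0‖ * ‖h z‖ ≤ ‖1 - (starRingEnd ℂ) (h 0) * h z‖ := by
    have := norm_sub_norm_le (1 : ℂ) ((starRingEnd ℂ) (h 0) * h z)
    simpa using this
  set a := ‖h 0‖
  set t := ‖h z‖
  set ρ := ‖z‖
  set X := ‖1 - (starRingEnd ℂ) (h 0) * h z‖
  have ha0 : 0 ≤ a := norm_nonneg _
  have ht0 : 0 ≤ t := norm_nonneg _
  have hρ0 : 0 ≤ ρ := norm_nonneg _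
  have h2 : ‖h z - h 0‖ ^ 2 ≤ ρ ^ 2 * X ^ 2 := by
    rw [← mul_pow]; exact pow_le_pow_left₀ (norm_nonneg _) hsp 2
  have hat : 0 ≤ 1 - a * t := by nlinarith
  have h3 : (1 - a * t) ^ 2 ≤ X ^ 2 := pow_le_pow_left₀ hat hlow 2
  have h4 : (t - a) ^ 2 ≤ (ρ * (1 - a * t)) ^ 2 := by
    have : (1 - ρ ^ 2) * (1 - a * t) ^ 2 ≤ (1 - ρ ^ 2) * X ^ 2 :=
      mul_le_mul_of_nonneg_left h3 (by nlinarith)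
    nlinarith
  have h5 : t - a ≤ ρ * (1 - a * t) :=
    le_of_sq_le_sq h4 (by positivity)
  rw [le_div_iff₀ (by positivity)]
  nlinarith

/-! ### Quotients, derivatives and products of analytic functions. -/

/-- The quotient of two analytic functions, the first dominated by the second. -/
theorem exists_memB_eq_mul {F H : ℂ → ℂ} (hF : DifferentiableOn ℂ F (ball 0 1))
    (hH : DifferentiableOn ℂ H (ball 0 1)) (hle : ∀ z ∈ ball (0 : ℂ) 1, ‖F z‖ ≤ ‖H z‖)
    (hne : ∃ z ∈ ball (0 : ℂ) 1, H z ≠ 0) :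
    ∃ ω : ℂ → ℂ, MemB ω ∧ ∀ z ∈ ball (0 : ℂ) 1, F z = ω z * H z := by
  have hHan : AnalyticOnNhd ℂ H (ball 0 1) := hH.analyticOnNhd isOpen_ball
  have hiso : ∀ c ∈ ball (0 : ℂ) 1, ∀ᶠ z in nhdsWithin c {c}ᶜ, H z ≠ 0 := by
    intro c hc
    refine (hHan c hc).eventually_eq_zero_or_eventually_ne_zero.resolve_left fun h0 => ?_
    obtain ⟨z, hz, hz0⟩ := hne
    exact hz0 (hHan.eqOn_zero_of_preconnected_of_eventuallyEq_zero
      (convex_ball 0 1).isPreconnected hc h0 hz)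
  set Q : ℂ → ℂ := fun z => F z / H z with hQ
  have hQle : ∀ z ∈ ball (0 : ℂ) 1, ‖Q z‖ ≤ 1 := by
    intro z hz
    rw [hQ]
    simp only [norm_div]
    exact div_le_one_of_le₀ (hle z hz) (norm_nonneg _)
  have hQd : ∀ z ∈ ball (0 : ℂ) 1, H z ≠ 0 → DifferentiableAt ℂ Q z := fun z hz h0 =>
    (hF.differentiableAt (isOpen_ball.mem_nhds hz)).div
      (hH.differentiableAt (isOpen_ball.mem_nhds hz)) h0
  -- Taking the punctured limit everywhere gives one formula that agrees with Q off the zeros of H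
  -- and with its removable extension at each of these isolated zeros.
  set ω : ℂ → ℂ := fun z => (nhdsWithin z {z}ᶜ).limUnder Q with hω
  have hωQ : ∀ z ∈ ball (0 : ℂ) 1, H z ≠ 0 → ω z = Q z := fun z hz h0 =>
    ((hQd z hz h0).continuousAt.tendsto.mono_left nhdsWithin_le_nhds).limUnder_eq
  have hloc : ∀ c ∈ ball (0 : ℂ) 1, DifferentiableAt ℂ ω c := by
    intro c hc
    have hev : ∀ᶠ z in nhds c, z ∈ ball (0 : ℂ) 1 ∧ (z ≠ c → H z ≠ 0) :=
      (isOpen_ball.eventually_mem hc).and (eventually_nhdsWithin_iff.1 (hiso c hc))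
    set s : Set ℂ := {z | z ∈ ball (0 : ℂ) 1 ∧ (z ≠ c → H z ≠ 0)} with hs
    have hsn : s ∈ nhds c := hev
    have hupd := Complex.differentiableOn_update_limUnder_of_bddAbove (f := Q) hsn
      (fun z hz => (hQd z hz.1.1 (hz.1.2 hz.2)).differentiableWithinAt)
      ⟨1, by rintro _ ⟨z, hz, rfl⟩; exact hQle z hz.1.1⟩
    refine (hupd.differentiableAt hsn).congr_of_eventuallyEq ?_
    filter_upwards [hsn] with z hz
    by_cases hzc : z = c
    · subst hzc
      simp [hω]
    · rw [Function.update_of_ne hzc]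
      exact hωQ z hz.1 (hz.2 hzc)
  have hωle : ∀ z ∈ ball (0 : ℂ) 1, ‖ω z‖ ≤ 1 := by
    intro c hc
    have ht : Filter.Tendsto (fun z => ‖ω z‖) (nhdsWithin c {c}ᶜ) (nhds ‖ω c‖) :=
      (hloc c hc).continuousAt.norm.tendsto.mono_left nhdsWithin_le_nhds
    refine le_of_tendsto ht ?_
    filter_upwards [hiso c hc, nhdsWithin_le_nhds (isOpen_ball.mem_nhds hc)] with z hz hzb
    rw [hωQ z hzb hz]
    exact hQle z hzb
  refine ⟨ω, ⟨fun z hz => (hloc z hz).differentiableWithinAt, hωle⟩, fun z hz => ?_⟩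
  by_cases h0 : H z = 0
  · have := hle z hz
    rw [h0, norm_zero] at this
    simp [h0, norm_le_zero_iff.1 this]
  · rw [hωQ z hz h0, hQ]
    field_simp

theorem taylorCoeff_deriv (f : ℂ → ℂ) (n : ℕ) :
    taylorCoeff (deriv f) n = (n + 1) * taylorCoeff f (n + 1) := by
  simp only [taylorCoeff, iteratedDeriv_succ', Nat.factorial_succ, Nat.cast_mul, Nat.cast_succ]
  have : (n.factorial : ℂ) ≠ 0 := by exact_mod_cast n.factorial_ne_zero
  have : (n : ℂ) + 1 ≠ 0 := by exact_mod_cast n.succ_ne_zero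
  field_simp

theorem taylorCoeff_congr {f g : ℂ → ℂ} (h : ∀ z ∈ ball (0 : ℂ) 1, f z = g z) (n : ℕ) :
    taylorCoeff f n = taylorCoeff g n := by
  have : f =ᶠ[nhds 0] g := by
    filter_upwards [isOpen_ball.mem_nhds (mem_ball_self one_pos)] with z hz using h z hz
  rw [taylorCoeff, taylorCoeff, this.iteratedDeriv_eq]

theorem taylorCoeff_mul {f g : ℂ → ℂ} (hf : DifferentiableOn ℂ f (ball 0 1))
    (hg : DifferentiableOn ℂ g (ball 0 1)) (n : ℕ) :
    taylorCoeff (fun z => f z * g z) n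
      = ∑ j ∈ Finset.range (n + 1), taylorCoeff f (n - j) * taylorCoeff g j := by
  have hc : ∀ f : ℂ → ℂ, DifferentiableOn ℂ f (ball 0 1) → ContDiffAt ℂ n f 0 := fun f hf =>
    (hf.analyticAt (isOpen_ball.mem_nhds (mem_ball_self one_pos))).contDiffAt
  rw [taylorCoeff, iteratedDeriv_fun_mul (hc f hf) (hc g hg), Finset.sum_div,
    ← Finset.sum_range_reflect]
  refine Finset.sum_congr rfl fun j hj => ?_
  have hj' : j ≤ n := Nat.lt_succ_iff.1 (Finset.mem_range.1 hj)
  have e : n + 1 - 1 - j = n - j := by omega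
  rw [e, Nat.sub_sub_self hj', Nat.choose_symm hj', taylorCoeff, taylorCoeff,
    Nat.cast_choose ℂ hj']
  have h1 : (n.factorial : ℂ) ≠ 0 := by exact_mod_cast n.factorial_ne_zero
  have h2 : (j.factorial : ℂ) ≠ 0 := by exact_mod_cast j.factorial_ne_zero
  have h3 : ((n - j).factorial : ℂ) ≠ 0 := by exact_mod_cast (n - j).factorial_ne_zero
  field_simp

/-! ### Carlson's inequalities. -/

theorem exists_norm_add_mul_eq (x y : ℂ) {b : ℝ} (hb : 0 ≤ b) :
    ∃ β : ℂ, ‖β‖ = b ∧ ‖x + y * β‖ = ‖x‖ + ‖y‖ * b := by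
  refine ⟨b * Complex.exp ((x.arg - y.arg : ℝ) * Complex.I), ?_, ?_⟩
  · rw [norm_mul, Complex.norm_exp_ofReal_mul_I, Complex.norm_real, Real.norm_of_nonneg hb, mul_one]
  · have hx := Complex.norm_mul_exp_arg_mul_I x
    have hy := Complex.norm_mul_exp_arg_mul_I y
    have : x + y * (b * Complex.exp ((x.arg - y.arg : ℝ) * Complex.I))
        = ((‖x‖ + ‖y‖ * b : ℝ) : ℂ) * Complex.exp (x.arg * Complex.I) := by
      have he : Complex.exp (x.arg * Complex.I) = Complex.exp (y.arg * Complex.I)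
          * Complex.exp ((x.arg - y.arg : ℝ) * Complex.I) := by
        rw [← Complex.exp_add]; congr 1; push_cast; ring
      push_cast at he ⊢
      linear_combination -hx - b * Complex.exp ((x.arg - y.arg) * Complex.I) * hy - ‖y‖ * b * he
    rw [this, norm_mul, Complex.norm_exp_ofReal_mul_I, Complex.norm_real,
      Real.norm_of_nonneg (by positivity), mul_one]

/-- The optimal choice is γ = W/(1 - S), for which W + γS = γ. Here W is the output entry to be
bounded, S the squared length of the tested segment of coefficients, and E, B the extra output and
input energies. -/
theorem sq_norm_le_of_forall_perturbation {W : ℂ} {S E B : ℝ} (hS : S < 1)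
    (h : ∀ γ : ℂ, S + E + ‖W + γ * S‖ ^ 2 ≤ 1 + B + ‖γ‖ ^ 2 * S) :
    ‖W‖ ^ 2 ≤ (1 - S) * (1 - S + B - E) := by
  have hD : 0 < 1 - S := by linarith
  have hDc : (1 : ℂ) - S ≠ 0 := by exact_mod_cast hD.ne'
  have := h (W / ((1 - S : ℝ) : ℂ))
  have e : W + W / ((1 - S : ℝ) : ℂ) * S = W / ((1 - S : ℝ) : ℂ) := by
    push_cast; field_simp; ring
  rw [e, norm_div, Complex.norm_real, Real.norm_of_nonneg hD.le] at this
  have h2 : (‖W‖ / (1 - S)) ^ 2 * (1 - S) ≤ 1 - S + B - E := by linarith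
  have h3 : (‖W‖ / (1 - S)) ^ 2 * (1 - S) = ‖W‖ ^ 2 / (1 - S) := by field_simp
  rw [h3, div_le_iff₀ hD] at h2
  linarith

theorem sum_mul_conj_reflect (a : ℕ → ℂ) (γ : ℂ) (k : ℕ) :
    ∑ i ∈ Finset.range k, a (k - 1 - i) * (γ * (starRingEnd ℂ) (a (k - 1 - i)))
      = γ * ((∑ i ∈ Finset.range k, ‖a i‖ ^ 2 : ℝ) : ℂ) := by
  rw [Finset.sum_range_reflect (fun i => a i * (γ * (starRingEnd ℂ) (a i)))]
  push_cast
  rw [Finset.mul_sum]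
  refine Finset.sum_congr rfl fun i _ => ?_
  rw [← Complex.mul_conj']
  ring

theorem sum_sq_norm_conj_reflect (a : ℕ → ℂ) (γ : ℂ) (k : ℕ) :
    ∑ i ∈ Finset.range k, ‖γ * (starRingEnd ℂ) (a (k - 1 - i))‖ ^ 2
      = ‖γ‖ ^ 2 * ∑ i ∈ Finset.range k, ‖a i‖ ^ 2 := by
  rw [Finset.sum_range_reflect (fun i => ‖γ * (starRingEnd ℂ) (a i)‖ ^ 2), Finset.mul_sum]
  refine Finset.sum_congr rfl fun i _ => ?_
  rw [norm_mul, RCLike.norm_conj, mul_pow]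

theorem sum_range_eq_first {f : ℕ → ℂ} {k : ℕ} (hk : 1 ≤ k)
    (h : ∀ j, 1 ≤ j → j < k → f j = 0) : ∑ j ∈ Finset.range k, f j = f 0 :=
  Finset.sum_eq_single_of_mem 0 (Finset.mem_range.2 hk) fun j hj hj0 =>
    h j (Nat.one_le_iff_ne_zero.2 hj0) (Finset.mem_range.1 hj)

/-- **Carlson's inequality** for coefficients of odd index. -/
theorem MemB.norm_taylorCoeff_odd_le {h : ℂ → ℂ} (hh : MemB h) {k : ℕ} (hk : 1 ≤ k) :
    ‖taylorCoeff h (2 * k - 1)‖ ≤ 1 - ∑ i ∈ Finset.range k, ‖taylorCoeff h i‖ ^ 2 := by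
  set a := taylorCoeff h with ha
  set S := ∑ i ∈ Finset.range k, ‖a i‖ ^ 2 with hS
  have hsum := hh.sum_sq_norm_le_one (2 * k - 1 + 1)
  have hS1 : S + ‖a (2 * k - 1)‖ ^ 2 ≤ 1 := by
    rw [Finset.sum_range_succ] at hsum
    refine le_trans (add_le_add_left ?_ _) hsum
    exact Finset.sum_le_sum_of_subset_of_nonneg (Finset.range_mono (by omega))
      fun _ _ _ => by positivity
  rcases (show S ≤ 1 by nlinarith [sq_nonneg ‖a (2 * k - 1)‖]).eq_or_lt with h1 | h1
  · have : ‖a (2 * k - 1)‖ = 0 := by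
      have := norm_nonneg (a (2 * k - 1))
      nlinarith
    rw [this, h1, sub_self]
  have hmain : ∀ γ : ℂ, S + 0 + ‖a (2 * k - 1) + γ * S‖ ^ 2 ≤ 1 + 0 + ‖γ‖ ^ 2 * S := by
    intro γ
    -- The unit vector e₀ reproduces a₀, …, a_{k-1} in the first k rows. The conjugated, reversed
    -- block adds γS to the last row, at input cost |γ|²S.
    set p : ℕ → ℂ := fun j => if j = 0 then 1 else if j < k then 0 else
      γ * (starRingEnd ℂ) (a (k - 1 - (j - k))) with hp
    have hp0 : p 0 = 1 := by simp [hp]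
    have hp1 : ∀ j, 1 ≤ j → j < k → p j = 0 := fun j h1 h2 => by
      simp [hp, h2, Nat.one_le_iff_ne_zero.1 h1]
    have hp2 : ∀ i, p (k + i) = γ * (starRingEnd ℂ) (a (k - 1 - i)) := fun i => by
      have : k ≠ 0 := by omega
      simp [hp, this]
    have hT := hh.sum_sq_norm_conv_le p (k + k)
    rw [Finset.sum_range_add (fun n => ‖p n‖ ^ 2)] at hT
    simp only [hp2, sum_sq_norm_conj_reflect] at hT
    have hhead : ∑ j ∈ Finset.range k, ‖p j‖ ^ 2 = 1 := by
      rw [Finset.sum_eq_single_of_mem 0 (Finset.mem_range.2 hk), hp0]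
      · simp
      · intro j hj hj0
        simp [hp1 j (Nat.one_le_iff_ne_zero.2 hj0) (Finset.mem_range.1 hj)]
    rw [hhead] at hT
    refine le_trans ?_ (hT.trans_eq (by rw [add_zero]))
    rw [show k + k = (k + (k - 1)) + 1 by omega, Finset.sum_range_succ, Finset.sum_range_add]
    have hrow : ∀ n ∈ Finset.range k,
        ‖∑ j ∈ Finset.range (n + 1), taylorCoeff h (n - j) * p j‖ ^ 2 = ‖a n‖ ^ 2 := by
      intro n hn
      rw [sum_range_eq_first (by omega)]
      · simp [hp0, ha]
      · intro j h1 h2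
        rw [hp1 j h1 (by have := Finset.mem_range.1 hn; omega), mul_zero]
    have hlast : ∑ j ∈ Finset.range (k + (k - 1) + 1), taylorCoeff h (k + (k - 1) - j) * p j
        = a (2 * k - 1) + γ * S := by
      rw [show k + (k - 1) + 1 = k + k by omega, Finset.sum_range_add]
      congr 1
      · rw [sum_range_eq_first hk]
        · rw [hp0, mul_one, ha]; congr 1; omega
        · intro j h1 h2
          rw [hp1 j h1 h2, mul_zero]
      · rw [← sum_mul_conj_reflect]
        refine Finset.sum_congr rfl fun i hi => ?_
        rw [hp2, ha]; congr 2; omega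
    rw [hlast, Finset.sum_congr rfl hrow, add_zero]
    have : 0 ≤ ∑ x ∈ Finset.range (k - 1),
      ‖∑ j ∈ Finset.range (k + x + 1), taylorCoeff h (k + x - j) * p j‖ ^ 2 := by positivity
    linarith
  have := sq_norm_le_of_forall_perturbation h1 hmain
  exact le_of_sq_le_sq (by nlinarith) (by linarith)

/-- **Carlson's inequality** for coefficients of even index. -/
theorem MemB.norm_taylorCoeff_even_le {h : ℂ → ℂ} (hh : MemB h) {k : ℕ} (hk : 1 ≤ k) :
    ‖taylorCoeff h (2 * k)‖ ≤ 1 - ∑ i ∈ Finset.range k, ‖taylorCoeff h i‖ ^ 2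
      - ‖taylorCoeff h k‖ ^ 2 / (1 + ‖h 0‖) := by
  rw [← taylorCoeff_zero h]
  set a := taylorCoeff h with ha
  set S := ∑ i ∈ Finset.range k, ‖a i‖ ^ 2 with hS
  have hsum := hh.sum_sq_norm_le_one (2 * k + 1)
  have hS1 : S + ‖a k‖ ^ 2 + ‖a (2 * k)‖ ^ 2 ≤ 1 := by
    rw [Finset.sum_range_succ] at hsum
    refine le_trans (add_le_add_left ?_ _) hsum
    rw [hS, ← Finset.sum_range_succ (fun i => ‖a i‖ ^ 2)]
    exact Finset.sum_le_sum_of_subset_of_nonneg (Finset.range_mono (by omega))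
      fun _ _ _ => by positivity
  rcases (show S ≤ 1 by nlinarith [sq_nonneg ‖a k‖, sq_nonneg ‖a (2 * k)‖]).eq_or_lt with h1 | h1
  · have e1 : ‖a (2 * k)‖ = 0 := by
      have := norm_nonneg (a (2 * k))
      nlinarith [sq_nonneg ‖a k‖]
    have e2 : ‖a k‖ = 0 := by
      have := norm_nonneg (a k)
      nlinarith [sq_nonneg ‖a (2 * k)‖]
    simp [e1, e2, h1]
  set c := ‖a 0‖
  have hc0 : 0 ≤ c := norm_nonneg _
  -- The phase of β aligns a_kβ with a_{2k}. The modulus |a_k|/(1 + c) solves |a_k| - c|β| = |β|, so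
  -- row k returns at least the energy spent on β.
  obtain ⟨β, hβ, hβW⟩ := exists_norm_add_mul_eq (a (2 * k)) (a k)
    (b := ‖a k‖ / (1 + c)) (by positivity)
  have hE : ‖β‖ ^ 2 ≤ ‖a k + a 0 * β‖ ^ 2 := by
    refine pow_le_pow_left₀ (norm_nonneg _) ?_ 2
    have h2 := norm_sub_norm_le (a k) (-(a 0 * β))
    rw [sub_neg_eq_add, norm_neg, norm_mul, hβ] at h2
    rw [hβ]
    refine le_trans (le_of_eq ?_) h2
    simp only [c]
    field_simp
    ring
  have hmain : ∀ γ : ℂ, S + ‖a k + a 0 * β‖ ^ 2 + ‖(a (2 * k) + a k * β) + γ * S‖ ^ 2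
      ≤ 1 + ‖β‖ ^ 2 + ‖γ‖ ^ 2 * S := by
    intro γ
    set p : ℕ → ℂ := fun j => if j = 0 then 1 else if j < k then 0 else if j = k then β else
      γ * (starRingEnd ℂ) (a (k - 1 - (j - (k + 1)))) with hp
    have hp0 : p 0 = 1 := by simp [hp]
    have hp1 : ∀ j, 1 ≤ j → j < k → p j = 0 := fun j h1 h2 => by
      simp [hp, h2, Nat.one_le_iff_ne_zero.1 h1]
    have hpk : p k = β := by
      have : k ≠ 0 := by omega
      simp [hp, this]
    have hp2 : ∀ i, p (k + 1 + i) = γ * (starRingEnd ℂ) (a (k - 1 - i)) := fun i => by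
      have h3 : ¬ k + 1 + i < k := by omega
      have h4 : ¬ k + 1 + i = k := by omega
      simp [hp, h3, h4]
    have hT := hh.sum_sq_norm_conv_le p (k + 1 + k)
    rw [Finset.sum_range_add (fun n => ‖p n‖ ^ 2), Finset.sum_range_succ (fun n => ‖p n‖ ^ 2)] at hT
    simp only [hp2, sum_sq_norm_conj_reflect] at hT
    have hhead : ∑ j ∈ Finset.range k, ‖p j‖ ^ 2 = 1 := by
      rw [Finset.sum_eq_single_of_mem 0 (Finset.mem_range.2 hk), hp0]
      · simp
      · intro j hj hj0
        simp [hp1 j (Nat.one_le_iff_ne_zero.2 hj0) (Finset.mem_range.1 hj)]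
    rw [hhead, hpk] at hT
    refine le_trans ?_ hT
    rw [show k + 1 + k = (k + 1 + (k - 1)) + 1 by omega, Finset.sum_range_succ,
      Finset.sum_range_add, Finset.sum_range_succ _ k]
    have hrow : ∀ n ∈ Finset.range k,
        ‖∑ j ∈ Finset.range (n + 1), taylorCoeff h (n - j) * p j‖ ^ 2 = ‖a n‖ ^ 2 := by
      intro n hn
      rw [sum_range_eq_first (by omega)]
      · simp [hp0, ha]
      · intro j h1 h2
        rw [hp1 j h1 (by have := Finset.mem_range.1 hn; omega), mul_zero]
    have hmid : ∑ j ∈ Finset.range (k + 1), taylorCoeff h (k - j) * p j = a k + a 0 * β := by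
      rw [Finset.sum_range_succ, sum_range_eq_first hk]
      · simp [hp0, hpk, ha]
      · intro j h1 h2
        rw [hp1 j h1 h2, mul_zero]
    have hlast : ∑ j ∈ Finset.range (k + 1 + (k - 1) + 1),
        taylorCoeff h (k + 1 + (k - 1) - j) * p j = (a (2 * k) + a k * β) + γ * S := by
      rw [show k + 1 + (k - 1) + 1 = k + 1 + k by omega, Finset.sum_range_add]
      congr 1
      · rw [Finset.sum_range_succ, sum_range_eq_first hk]
        · rw [hp0, mul_one, hpk, ha]; congr 3 <;> omega
        · intro j h1 h2
          rw [hp1 j h1 h2, mul_zero]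
      · rw [← sum_mul_conj_reflect]
        refine Finset.sum_congr rfl fun i hi => ?_
        rw [hp2, ha]; congr 2; omega
    rw [hlast, hmid, Finset.sum_congr rfl hrow]
    have : 0 ≤ ∑ x ∈ Finset.range (k - 1),
      ‖∑ j ∈ Finset.range (k + 1 + x + 1), taylorCoeff h (k + 1 + x - j) * p j‖ ^ 2 := by
        positivity
    linarith
  have h6 := sq_norm_le_of_forall_perturbation h1 hmain
  have h7 : ‖a (2 * k) + a k * β‖ ≤ 1 - S := le_of_sq_le_sq (by nlinarith) (by linarith)
  rw [hβW] at h7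
  have : ‖a k‖ ^ 2 / (1 + c) = ‖a k‖ * (‖a k‖ / (1 + c)) := by ring
  linarith

/-- Wiener's bound: only |a₀|² is kept from the square sum in Carlson's inequalities. -/
theorem MemB.norm_taylorCoeff_le {h : ℂ → ℂ} (hh : MemB h) {n : ℕ} (hn : 1 ≤ n) :
    ‖taylorCoeff h n‖ ≤ 1 - ‖h 0‖ ^ 2 := by
  have hfirst : ∀ k, 1 ≤ k → ‖h 0‖ ^ 2 ≤ ∑ i ∈ Finset.range k, ‖taylorCoeff h i‖ ^ 2 := by
    intro k hk
    rw [← taylorCoeff_zero h]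
    exact Finset.single_le_sum (f := fun i => ‖taylorCoeff h i‖ ^ 2) (fun _ _ => by positivity)
      (Finset.mem_range.2 hk)
  rcases Nat.even_or_odd' n with ⟨k, rfl | rfl⟩
  · have hk : 1 ≤ k := by omega
    have h1 := hh.norm_taylorCoeff_even_le hk
    have h2 : 0 ≤ ‖taylorCoeff h k‖ ^ 2 / (1 + ‖h 0‖) := by positivity
    linarith [hfirst k hk]
  · have h1 := hh.norm_taylorCoeff_odd_le (k := k + 1) (by omega)
    rw [show 2 * (k + 1) - 1 = 2 * k + 1 by omega] at h1
    linarith [hfirst (k + 1) (by omega)]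

/-! ### The refined Bohr inequality and the sharp square-sum bound. -/

/-- The subtracted remainder is what makes the induction close. Each step adds the coefficients of
index 2J + 2 and 2J + 3, and the even and odd Carlson bounds combine with the new square term into
an exact telescoping identity. -/
theorem MemB.sum_le_of_carlson {h : ℂ → ℂ} (hh : MemB h) {r : ℝ} (h0 : 0 ≤ r) (h1 : r < 1)
    (J : ℕ) :
    ∑ n ∈ Finset.range (2 * J + 1), ‖taylorCoeff h (n + 1)‖ * r ^ (n + 1)
      + 1 / (1 + ‖h 0‖) * ((1 + ‖h 0‖ * r) / (1 - r))
        * ∑ j ∈ Finset.range J, ‖taylorCoeff h (j + 1)‖ ^ 2 * r ^ (2 * (j + 1))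
      ≤ (1 - ‖h 0‖ ^ 2) * (r / (1 - r))
        - (1 - ∑ i ∈ Finset.range (J + 1), ‖taylorCoeff h i‖ ^ 2) * (r ^ (2 * J + 2) / (1 - r)) := by
  have hr : 0 < 1 - r := by linarith
  induction J with
  | zero =>
    have := hh.norm_taylorCoeff_le (n := 1) le_rfl
    simp only [mul_zero, zero_add, Finset.sum_range_one, Finset.range_zero, Finset.sum_empty,
      pow_one, add_zero, taylorCoeff_zero]
    have e : (1 - ‖h 0‖ ^ 2) * (r / (1 - r)) - (1 - ‖h 0‖ ^ 2) * (r ^ 2 / (1 - r))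
        = (1 - ‖h 0‖ ^ 2) * r := by field_simp
    rw [e]
    exact mul_le_mul_of_nonneg_right this h0
  | succ J ih =>
    have he := hh.norm_taylorCoeff_even_le (k := J + 1) (by omega)
    have ho := hh.norm_taylorCoeff_odd_le (k := J + 2) (by omega)
    rw [show 2 * (J + 2) - 1 = 2 * J + 2 + 1 by omega, Finset.sum_range_succ] at ho
    rw [show 2 * (J + 1) + 1 = 2 * J + 1 + 1 + 1 by ring, Finset.sum_range_succ,
      Finset.sum_range_succ, Finset.sum_range_succ _ J, Finset.sum_range_succ _ (J + 1)]
    rw [show 2 * (J + 1) = 2 * J + 1 + 1 by ring] at he ⊢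
    set T := ∑ i ∈ Finset.range (J + 1), ‖taylorCoeff h i‖ ^ 2
    set X := r ^ (2 * J + 1 + 1) with hX
    have hX0 : 0 ≤ X := by positivity
    set d := ‖taylorCoeff h (J + 1)‖ ^ 2
    set c := ‖h 0‖
    have hc : 0 < 1 + c := by positivity
    have e1 : r ^ (2 * J + 1 + 1 + 1) = r * X := by rw [hX]; ring
    have e2 : r ^ (2 * J + 1 + 1 + 2) = r ^ 2 * X := by rw [hX]; ring
    rw [e1, e2]
    have h3 := mul_le_mul_of_nonneg_right he hX0
    have h4 := mul_le_mul_of_nonneg_right ho (mul_nonneg h0 hX0)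
    have key : (1 - c ^ 2) * (r / (1 - r)) - (1 - T) * (X / (1 - r)) + (1 - T - d / (1 + c)) * X
        + (1 - (T + d)) * (r * X) + 1 / (1 + c) * ((1 + c * r) / (1 - r)) * (d * X)
        = (1 - c ^ 2) * (r / (1 - r)) - (1 - (T + d)) * (r ^ 2 * X / (1 - r)) := by
      field_simp
      ring
    rw [← key, mul_add]
    linarith

/-- The refined Bohr-type inequality for functions of the class `𝓑`. -/
theorem MemB.majorant_add_le {h : ℂ → ℂ} (hh : MemB h) {r : ℝ} (h0 : 0 ≤ r) (h1 : r < 1) :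
    majorant h r + 1 / (1 + ‖h 0‖) * ((1 + ‖h 0‖ * r) / (1 - r)) * normSqR h r
      ≤ (1 - ‖h 0‖ ^ 2) * (r / (1 - r)) := by
  have t1 := ((summable_majorant hh.analytic h0 h1).hasSum.tendsto_sum_nat).comp
    (Filter.tendsto_atTop_mono (fun J : ℕ => (by omega : J ≤ 2 * J + 1)) Filter.tendsto_id)
  have t2 := (summable_normSqR hh.analytic h0 h1).hasSum.tendsto_sum_nat
  refine le_of_tendsto (t1.add (t2.const_mul (1 / (1 + ‖h 0‖) * ((1 + ‖h 0‖ * r) / (1 - r)))))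
    (Filter.Eventually.of_forall fun J => (hh.sum_le_of_carlson h0 h1 J).trans ?_)
  have : 0 ≤ (1 - ∑ i ∈ Finset.range (J + 1), ‖taylorCoeff h i‖ ^ 2)
      * (r ^ (2 * J + 2) / (1 - r)) :=
    mul_nonneg (by linarith [hh.sum_sq_norm_le_one (J + 1)])
      (div_nonneg (by positivity) (by linarith))
  linarith

/-- Parseval applied to Schwarz–Pick on |z| = r. Writing 1 - conj(a₀)h as (1 - |a₀|²) - conj(a₀)(h -
a₀) brings the same square sum to both sides. Möbius maps give equality. -/
theorem MemB.normSqR_mul_le {h : ℂ → ℂ} (hh : MemB h) (hlt : ‖h 0‖ < 1) {r : ℝ}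
    (h0 : 0 ≤ r) (h1 : r < 1) :
    normSqR h r * (1 - ‖h 0‖ ^ 2 * r ^ 2) ≤ (1 - ‖h 0‖ ^ 2) ^ 2 * r ^ 2 := by
  set a := taylorCoeff h with ha
  set c : ℕ → ℂ := fun n => if n = 0 then 0 else a n * (r : ℂ) ^ n with hc
  set d : ℕ → ℂ := fun n => if n = 0 then 0 else if n = 1 then (1 - (‖h 0‖ : ℂ) ^ 2) * r else
    -((starRingEnd ℂ) (h 0) * a (n - 1) * (r : ℂ) ^ n) with hd
  have hsa := summable_norm_taylorCoeff hh.analytic h0 h1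
  have hsc : Summable fun n => ‖c n‖ := by
    refine Summable.of_nonneg_of_le (fun _ => norm_nonneg _) (fun n => ?_) hsa
    by_cases hn : n = 0
    · simp [hc, hn]
    · simp [hc, hn, ha, abs_of_nonneg h0]
  have hd2 : ∀ n, d (n + 2) = -((starRingEnd ℂ) (h 0) * (a (n + 1) * (r : ℂ) ^ (n + 2))) := by
    intro n; simp [hd]; ring
  have hsd : Summable fun n => ‖d n‖ := by
    refine (summable_nat_add_iff 2).1 ?_
    have h3 := (((summable_nat_add_iff 1).2 hsa).mul_right r).mul_left ‖h 0‖
    refine h3.congr fun n => ?_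
    rw [hd2, norm_neg, norm_mul, norm_mul, RCLike.norm_conj, norm_pow, Complex.norm_real,
      Real.norm_of_nonneg h0]
    ring
  have hsq := summable_normSqR hh.analytic h0 h1
  have hle : ∀ z : ℂ, ‖z‖ = 1 → ‖∑' n, c n * z ^ n‖ ≤ ‖∑' n, d n * z ^ n‖ := by
    intro z hz
    have hrz : ‖(r : ℂ) * z‖ = r := by simp [hz, abs_of_nonneg h0]
    have hS := hasSum_taylorCoeff hh.analytic (z := r * z) (by rw [hrz]; exact h1)
    have hS1 := (hasSum_nat_add_iff' 1).2 hS
    simp only [Finset.sum_range_one, pow_zero, mul_one, taylorCoeff_zero] at hS1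
    have hcs : HasSum (fun n => c n * z ^ n) (h (r * z) - h 0) := by
      refine (hasSum_nat_add_iff' 1).1 ?_
      simp only [Finset.sum_range_one]
      refine (hS1.congr_fun fun n => ?_).trans_eq ?_
      · simp [hc, ha, mul_pow]; ring
      · simp [hc]
    have hds : HasSum (fun n => d n * z ^ n)
        (r * z * (1 - (starRingEnd ℂ) (h 0) * h (r * z))) := by
      refine (hasSum_nat_add_iff' 2).1 ?_
      have h4 := hS1.mul_left (-((starRingEnd ℂ) (h 0) * (r * z)))
      refine (h4.congr_fun fun n => ?_).trans_eq ?_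
      · rw [hd2]; simp [ha, mul_pow]; ring
      · simp [hd, Finset.sum_range_succ, ← Complex.mul_conj']; ring
    rw [hcs.tsum_eq, hds.tsum_eq, norm_mul]
    exact hh.norm_sub_le hlt (by rw [hrz]; exact h1)
  have hfin := fun N => sum_sq_norm_le_of_norm_le hsc hsd hle (N + 1)
    (S := (1 - ‖h 0‖ ^ 2) ^ 2 * r ^ 2 + ‖h 0‖ ^ 2 * r ^ 2 * normSqR h r) ?_
  · have hlim : normSqR h r
        ≤ (1 - ‖h 0‖ ^ 2) ^ 2 * r ^ 2 + ‖h 0‖ ^ 2 * r ^ 2 * normSqR h r := by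
      refine hsq.tsum_le_of_sum_range_le fun N => ?_
      refine le_trans (le_of_eq ?_) (hfin N)
      rw [Finset.sum_range_succ']
      simp [hc, ha, abs_of_nonneg h0, mul_pow, ← pow_mul, mul_comm]
    linarith
  · intro M
    have hmono : ∑ n ∈ Finset.range M, ‖d n‖ ^ 2 ≤ ∑ n ∈ Finset.range (M + 2), ‖d n‖ ^ 2 :=
      Finset.sum_le_sum_of_subset_of_nonneg (Finset.range_mono (by omega))
        fun _ _ _ => by positivity
    refine hmono.trans ?_
    rw [Finset.sum_range_succ', Finset.sum_range_succ']
    have e0 : ‖d 0‖ ^ 2 = 0 := by simp [hd]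
    have e1 : ‖d (0 + 1)‖ ^ 2 = (1 - ‖h 0‖ ^ 2) ^ 2 * r ^ 2 := by
      have : (1 - (‖h 0‖ : ℂ) ^ 2) * r = (((1 - ‖h 0‖ ^ 2) * r : ℝ) : ℂ) := by push_cast; ring
      simp only [hd, zero_add, one_ne_zero, if_true, if_false, this, Complex.norm_real]
      rw [Real.norm_eq_abs, sq_abs]; ring
    rw [e0, e1, add_zero, add_comm]
    refine add_le_add_right ?_ _
    have e2 : ∀ n ∈ Finset.range M, ‖d (n + 1 + 1)‖ ^ 2
        = ‖h 0‖ ^ 2 * r ^ 2 * (‖a (n + 1)‖ ^ 2 * r ^ (2 * (n + 1))) := by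
      intro n _
      rw [hd2, norm_neg, norm_mul, norm_mul, RCLike.norm_conj, norm_pow, Complex.norm_real,
        Real.norm_of_nonneg h0]
      ring
    rw [Finset.sum_congr rfl e2, ← Finset.mul_sum]
    exact mul_le_mul_of_nonneg_left (hsq.sum_le_tsum _ fun _ _ => by positivity) (by positivity)

/-! ### Comparing the coefficients of G with those of h. -/

/-- Summation by parts against a decreasing weight. -/
theorem mul_sub_le_sum_mul {δ d : ℕ → ℝ} (hδ : ∀ N, 0 ≤ ∑ n ∈ Finset.range N, δ n)
    (hd : Antitone d) (hd0 : ∀ n, 0 ≤ d n) (N : ℕ) :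
    δ 0 * (d 0 - d 1) ≤ ∑ n ∈ Finset.range (N + 1), δ n * d n := by
  have : δ 0 * (d 0 - d 1) + (∑ n ∈ Finset.range (N + 1), δ n) * d (N + 1)
      ≤ ∑ n ∈ Finset.range (N + 1), δ n * d n := by
    induction N with
    | zero => simp; ring_nf; rfl
    | succ N ih =>
      rw [Finset.sum_range_succ _ (N + 1), Finset.sum_range_succ _ (N + 1)]
      have h1 := hδ (N + 2)
      rw [Finset.sum_range_succ] at h1
      have := mul_le_mul_of_nonneg_left (hd (Nat.le_succ (N + 1))) h1
      simp only [Nat.succ_eq_add_one] at this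
      nlinarith
  nlinarith [mul_nonneg (hδ (N + 1)) (hd0 (N + 1))]

/-- `G` is analytic in the disk and `G' = ω h'` there, with `ω` in the class `𝓑`. -/
structure HasDilatation (ω h G : ℂ → ℂ) : Prop where
  memB : MemB ω
  analytic : DifferentiableOn ℂ G (ball 0 1)
  deriv_eq : ∀ z ∈ ball (0 : ℂ) 1, deriv G z = ω z * deriv h z

theorem exists_hasDilatation {h G : ℂ → ℂ} (hh : DifferentiableOn ℂ h (ball 0 1))
    (hn : NonconstantOnDisk h) (hG : DifferentiableOn ℂ G (ball 0 1))
    (hle : ∀ z ∈ ball (0 : ℂ) 1, ‖deriv G z‖ ≤ ‖deriv h z‖) : ∃ ω, HasDilatation ω h G := by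
  have hne : ∃ z ∈ ball (0 : ℂ) 1, deriv h z ≠ 0 := by
    by_contra! hcon
    refine hn ⟨h 0, fun z hz => ?_⟩
    exact isOpen_ball.is_const_of_deriv_eq_zero (convex_ball 0 1).isPreconnected hh
      (fun w hw => hcon w hw) hz (mem_ball_self one_pos)
  obtain ⟨ω, hω, heq⟩ := exists_memB_eq_mul (hG.deriv isOpen_ball) (hh.deriv isOpen_ball) hle hne
  exact ⟨ω, hω, hG, heq⟩

namespace HasDilatation

variable {ω h G : ℂ → ℂ}

theorem succ_mul_taylorCoeff (hd : HasDilatation ω h G) (hh : DifferentiableOn ℂ h (ball 0 1))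
    (n : ℕ) : (n + 1) * taylorCoeff G (n + 1)
      = ∑ j ∈ Finset.range (n + 1), taylorCoeff ω (n - j) * ((j + 1) * taylorCoeff h (j + 1)) := by
  rw [← taylorCoeff_deriv, taylorCoeff_congr hd.deriv_eq,
    taylorCoeff_mul hd.memB.analytic (hh.deriv isOpen_ball)]
  exact Finset.sum_congr rfl fun j _ => by rw [taylorCoeff_deriv]

theorem norm_taylorCoeff_one (hd : HasDilatation ω h G) (hh : DifferentiableOn ℂ h (ball 0 1)) :
    ‖taylorCoeff G 1‖ = ‖ω 0‖ * ‖taylorCoeff h 1‖ := by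
  have := hd.succ_mul_taylorCoeff hh 0
  simp [taylorCoeff_zero] at this
  rw [this, norm_mul]

/-- The Toeplitz contraction of ω applied to the coefficients (j + 1)a_{j+1} of h'. -/
theorem sum_defect_nonneg (hd : HasDilatation ω h G) (hh : DifferentiableOn ℂ h (ball 0 1))
    (N : ℕ) : 0 ≤ ∑ n ∈ Finset.range N,
      ((n : ℝ) + 1) ^ 2 * (‖taylorCoeff h (n + 1)‖ ^ 2 - ‖taylorCoeff G (n + 1)‖ ^ 2) := by
  have := hd.memB.sum_sq_norm_conv_le (fun j => (j + 1) * taylorCoeff h (j + 1)) N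
  simp only [← hd.succ_mul_taylorCoeff hh] at this
  rw [← sub_nonneg, ← Finset.sum_sub_distrib] at this
  refine this.trans_eq (Finset.sum_congr rfl fun n _ => ?_)
  have : ‖(n : ℂ) + 1‖ = n + 1 := by
    rw [← Nat.cast_succ, Complex.norm_natCast, Nat.cast_succ]
  rw [norm_mul, norm_mul, this]
  ring

/-- Abel summation removes the factors (n + 1)² coming from differentiation. Keeping the first
difference of the weights, r² - r⁴/4, leaves a surplus proportional to 1 - |ω(0)|². -/
theorem normSqR_le (hd : HasDilatation ω h G) (hh : DifferentiableOn ℂ h (ball 0 1)) {r : ℝ}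
    (h0 : 0 ≤ r) (h1 : r < 1) :
    normSqR G r + (1 - ‖ω 0‖ ^ 2) * (‖taylorCoeff h 1‖ ^ 2 * (r ^ 2 * (1 - r ^ 2 / 4)))
      ≤ normSqR h r := by
  set d : ℕ → ℝ := fun n => r ^ (2 * (n + 1)) / ((n : ℝ) + 1) ^ 2 with hdd
  have hd0 : ∀ n, 0 ≤ d n := fun n => by positivity
  have hanti : Antitone d := antitone_nat_of_succ_le fun n => by
    simp only [hdd]
    push_cast
    refine div_le_div₀ (by positivity) (pow_le_pow_of_le_one h0 h1.le (by omega)) (by positivity) ?_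
    exact pow_le_pow_left₀ (by positivity) (by linarith) 2
  have hs := (summable_normSqR hh h0 h1).sub (summable_normSqR hd.analytic h0 h1)
  have hsub : normSqR h r - normSqR G r = ∑' n : ℕ,
      (‖taylorCoeff h (n + 1)‖ ^ 2 * r ^ (2 * (n + 1))
        - ‖taylorCoeff G (n + 1)‖ ^ 2 * r ^ (2 * (n + 1))) :=
    ((summable_normSqR hh h0 h1).tsum_sub (summable_normSqR hd.analytic h0 h1)).symm
  have hlow : (1 - ‖ω 0‖ ^ 2) * (‖taylorCoeff h 1‖ ^ 2 * (r ^ 2 * (1 - r ^ 2 / 4)))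
      ≤ normSqR h r - normSqR G r := by
    rw [hsub]
    refine ge_of_tendsto (hs.hasSum.tendsto_sum_nat.comp (Filter.tendsto_add_atTop_nat 1))
      (Filter.Eventually.of_forall fun N => ?_)
    refine le_trans (le_of_eq ?_)
      ((mul_sub_le_sum_mul (hd.sum_defect_nonneg hh) hanti hd0 N).trans_eq ?_)
    · simp only [hdd, zero_add, hd.norm_taylorCoeff_one hh]
      norm_num
      ring
    · refine Finset.sum_congr rfl fun n _ => ?_
      simp only [hdd]
      have : (n : ℝ) + 1 ≠ 0 := by positivity
      field_simp
  linarith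

theorem norm_zero_le_one (hd : HasDilatation ω h G) : ‖ω 0‖ ≤ 1 := hd.memB.norm_zero_le

/-- The substitute for |G| ≤ 1: Abel summation with weights 1/(n + 1)² transfers the square-sum
bound for h to G. -/
theorem sum_sq_norm_le (hd : HasDilatation ω h G) (hh : MemB h) (N : ℕ) :
    ∑ n ∈ Finset.range N, ‖taylorCoeff G (n + 1)‖ ^ 2 ≤ 1 - ‖h 0‖ ^ 2 := by
  have hmono : ∑ n ∈ Finset.range N, ‖taylorCoeff G (n + 1)‖ ^ 2
      ≤ ∑ n ∈ Finset.range (N + 1), ‖taylorCoeff G (n + 1)‖ ^ 2 :=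
    Finset.sum_le_sum_of_subset_of_nonneg (Finset.range_mono (by omega)) fun _ _ _ => by positivity
  set d : ℕ → ℝ := fun n => 1 / ((n : ℝ) + 1) ^ 2 with hdd
  have hanti : Antitone d := antitone_nat_of_succ_le fun n => by
    simp only [hdd]
    push_cast
    refine div_le_div₀ zero_le_one le_rfl (by positivity) ?_
    exact pow_le_pow_left₀ (by positivity) (by linarith) 2
  have h2 := mul_sub_le_sum_mul (hd.sum_defect_nonneg hh.analytic) hanti
    (fun n => by simp only [hdd]; positivity) N
  have h3 : 0 ≤ ((0 : ℕ) + 1 : ℝ) ^ 2 * (‖taylorCoeff h (0 + 1)‖ ^ 2 - ‖taylorCoeff G (0 + 1)‖ ^ 2)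
      * (d 0 - d 1) := by
    refine mul_nonneg ?_ (sub_nonneg.2 (hanti zero_le_one))
    simpa using hd.sum_defect_nonneg hh.analytic 1
  have h4 : ∑ n ∈ Finset.range (N + 1), ((n : ℝ) + 1) ^ 2
      * (‖taylorCoeff h (n + 1)‖ ^ 2 - ‖taylorCoeff G (n + 1)‖ ^ 2) * d n
      = ∑ n ∈ Finset.range (N + 1), ‖taylorCoeff h (n + 1)‖ ^ 2
        - ∑ n ∈ Finset.range (N + 1), ‖taylorCoeff G (n + 1)‖ ^ 2 := by
    rw [← Finset.sum_sub_distrib]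
    refine Finset.sum_congr rfl fun n _ => ?_
    simp only [hdd]
    have : (n : ℝ) + 1 ≠ 0 := by positivity
    field_simp
  have h5 := hh.sum_sq_norm_le_one (N + 2)
  rw [Finset.sum_range_succ', taylorCoeff_zero] at h5
  linarith

theorem norm_taylorCoeff_succ_le (hd : HasDilatation ω h G)
    (hh : DifferentiableOn ℂ h (ball 0 1)) (n : ℕ) :
    ‖taylorCoeff G (n + 1)‖ ≤ ‖ω 0‖ * ‖taylorCoeff h (n + 1)‖
      + (1 - ‖ω 0‖ ^ 2) * ∑ j ∈ Finset.range n, ((j : ℝ) + 1) / (n + 1)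
        * ‖taylorCoeff h (j + 1)‖ := by
  have hn : (0 : ℝ) < (n : ℝ) + 1 := by positivity
  have hnorm : ∀ m : ℕ, ‖(m : ℂ) + 1‖ = m + 1 := fun m => by
    rw [← Nat.cast_succ, Complex.norm_natCast, Nat.cast_succ]
  have h1 := congrArg norm (hd.succ_mul_taylorCoeff hh n)
  rw [norm_mul, hnorm, Finset.sum_range_succ, Nat.sub_self, taylorCoeff_zero] at h1
  have h2 : ((n : ℝ) + 1) * ‖taylorCoeff G (n + 1)‖
      ≤ (1 - ‖ω 0‖ ^ 2) * (∑ j ∈ Finset.range n, ((j : ℝ) + 1) * ‖taylorCoeff h (j + 1)‖)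
        + ‖ω 0‖ * ((n + 1) * ‖taylorCoeff h (n + 1)‖) := by
    rw [h1]
    refine (norm_add_le _ _).trans (add_le_add ?_ ?_)
    · rw [Finset.mul_sum]
      refine (norm_sum_le _ _).trans (Finset.sum_le_sum fun j hj => ?_)
      rw [norm_mul, norm_mul, hnorm]
      exact mul_le_mul_of_nonneg_right (hd.memB.norm_taylorCoeff_le
        (by have := Finset.mem_range.1 hj; omega)) (by positivity)
    · rw [norm_mul, norm_mul, hnorm]
  have h3 : ∑ j ∈ Finset.range n, ((j : ℝ) + 1) / (n + 1) * ‖taylorCoeff h (j + 1)‖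
      = (∑ j ∈ Finset.range n, ((j : ℝ) + 1) * ‖taylorCoeff h (j + 1)‖) / (n + 1) := by
    rw [Finset.sum_div]
    exact Finset.sum_congr rfl fun j _ => by ring
  rw [h3]
  have h4 : ‖taylorCoeff G (n + 1)‖ ≤ ((1 - ‖ω 0‖ ^ 2)
      * (∑ j ∈ Finset.range n, ((j : ℝ) + 1) * ‖taylorCoeff h (j + 1)‖)
        + ‖ω 0‖ * ((n + 1) * ‖taylorCoeff h (n + 1)‖)) / (n + 1) := by
    rw [le_div_iff₀ hn]; linarith
  refine h4.trans_eq ?_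
  field_simp
  ring

end HasDilatation

/-! ### Majorant of G against majorant of h. -/

/-- A weighted Hardy-type inequality for `∑ₙ ∑_{j<n} (j+1)/(n+1) Aⱼ r^{n-j}`. -/
theorem summable_and_tsum_weighted_le {A : ℕ → ℝ} (hA0 : ∀ n, 0 ≤ A n) (hA : Summable A) {r : ℝ}
    (h0 : 0 ≤ r) (h1 : r < 1) :
    (Summable fun n : ℕ => ∑ j ∈ Finset.range n, ((j : ℝ) + 1) / (n + 1) * (A j * r ^ (n - j))) ∧
    ∑' n : ℕ, ∑ j ∈ Finset.range n, ((j : ℝ) + 1) / (n + 1) * (A j * r ^ (n - j))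
      ≤ r / (1 - r) * (∑' n, A n - 2 / 3 * A 0 - 1 / 2 * A 1) + A 0 * r / 6 + A 1 * r / 6 := by
  -- The weight (j + 1)/(n + 1) is at most 1/3 for j = 0 and 1/2 for j = 1, except at n = 1 and n =
  -- 2 respectively. There it is 1/2 and 2/3, an excess of 1/6 each time, which gives the two
  -- corrections r/6.
  set A' : ℕ → ℝ := fun j => A j - (if j = 0 then 2 / 3 * A 0 else 0)
    - (if j = 1 then 1 / 2 * A 1 else 0) with hA'
  have hA'0 : ∀ n, 0 ≤ A' n := by
    intro n
    have := hA0 n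
    rcases n with _ | _ | n <;> simp [hA'] <;> linarith
  have hhas : HasSum A' (∑' n, A n - 2 / 3 * A 0 - 1 / 2 * A 1) :=
    (hA.hasSum.sub (hasSum_ite_eq 0 _)).sub (hasSum_ite_eq 1 _)
  set g : ℕ → ℝ := fun i => if i = 0 then 0 else r ^ i with hg
  have hg0 : ∀ i, 0 ≤ g i := fun i => by simp only [hg]; split_ifs <;> positivity
  have hgs : HasSum g (r / (1 - r)) := by
    refine (hasSum_nat_add_iff' 1).1 ?_
    have := (hasSum_geometric_of_lt_one h0 h1).mul_left r
    simp only [Finset.sum_range_one]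
    refine (this.congr_fun fun n => ?_).trans_eq ?_
    · simp [hg, pow_succ']
    · simp [hg, div_eq_mul_inv]
  have hprod := hasSum_sum_range_mul_of_summable_norm hhas.summable.norm hgs.summable.norm
  rw [hhas.tsum_eq, hgs.tsum_eq] at hprod
  have he := ((hasSum_ite_eq (1 : ℕ) (A 0 * r / 6)).add (hasSum_ite_eq (2 : ℕ) (A 1 * r / 6)))
  have hall := hprod.add he
  have hle : ∀ n : ℕ, ∑ j ∈ Finset.range n, ((j : ℝ) + 1) / (n + 1) * (A j * r ^ (n - j))
      ≤ ∑ k ∈ Finset.range (n + 1), A' k * g (n - k)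
        + ((if n = 1 then A 0 * r / 6 else 0) + (if n = 2 then A 1 * r / 6 else 0)) := by
    intro n
    rw [Finset.sum_range_succ]
    have hgn : g (n - n) = 0 := by simp [hg]
    rw [hgn, mul_zero, add_zero]
    have hgj : ∀ j ∈ Finset.range n, A' j * g (n - j) = A' j * r ^ (n - j) := by
      intro j hj
      have : n - j ≠ 0 := by have := Finset.mem_range.1 hj; omega
      simp [hg, this]
    rw [Finset.sum_congr rfl hgj]
    rcases n with _ | _ | _ | n
    · simp
    · simp [hA']
      linarith
    · simp [hA', Finset.sum_range_succ]
      nlinarith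
    · simp only [show n + 1 + 1 + 1 ≠ 1 by omega, show n + 1 + 1 + 1 ≠ 2 by omega, if_false,
        add_zero]
      refine Finset.sum_le_sum fun j hj => ?_
      rw [← mul_assoc]
      refine mul_le_mul_of_nonneg_right ?_ (by positivity)
      have hj' : (j : ℝ) + 1 ≤ n + 3 := by
        have := Finset.mem_range.1 hj
        exact_mod_cast (by omega : j + 1 ≤ n + 3)
      have hn0 : (0 : ℝ) ≤ n := Nat.cast_nonneg n
      push_cast
      rcases j with _ | _ | j
      · have : ((0 : ℕ) + 1 : ℝ) / (n + 1 + 1 + 1 + 1) ≤ 1 / 3 := by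
          rw [div_le_div_iff₀ (by positivity) (by norm_num)]; push_cast; linarith
        have := mul_le_mul_of_nonneg_right this (hA0 0)
        simp [hA'] at this ⊢
        linarith
      · have : ((0 + 1 : ℕ) + 1 : ℝ) / (n + 1 + 1 + 1 + 1) ≤ 1 / 2 := by
          rw [div_le_div_iff₀ (by positivity) (by norm_num)]; push_cast; linarith
        have := mul_le_mul_of_nonneg_right this (hA0 1)
        simp [hA'] at this ⊢
        linarith
      · have : ((j + 1 + 1 : ℕ) + 1 : ℝ) / (n + 1 + 1 + 1 + 1) ≤ 1 := by
          rw [div_le_one (by positivity)]; linarith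
        have := mul_le_mul_of_nonneg_right this (hA0 (j + 1 + 1))
        simp [hA'] at this ⊢
        linarith
  have hsum := Summable.of_nonneg_of_le (fun n => Finset.sum_nonneg fun j _ => by
    have := hA0 j; positivity) hle hall.summable
  refine ⟨hsum, ?_⟩
  refine (hsum.tsum_le_tsum hle hall.summable).trans_eq ?_
  rw [hall.tsum_eq]
  ring

theorem HasDilatation.majorant_le {ω h G : ℂ → ℂ} (hd : HasDilatation ω h G)
    (hh : DifferentiableOn ℂ h (ball 0 1)) {r : ℝ} (h0 : 0 ≤ r) (h1 : r < 1) :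
    majorant G r ≤ ‖ω 0‖ * majorant h r + (1 - ‖ω 0‖ ^ 2) *
      (r / (1 - r) * (majorant h r - 2 / 3 * (‖taylorCoeff h 1‖ * r)
        - 1 / 2 * (‖taylorCoeff h 2‖ * r ^ 2))
        + ‖taylorCoeff h 1‖ * r * r / 6 + ‖taylorCoeff h 2‖ * r ^ 2 * r / 6) := by
  have hsA := summable_majorant hh h0 h1
  obtain ⟨hs, hle⟩ := summable_and_tsum_weighted_le
    (A := fun n => ‖taylorCoeff h (n + 1)‖ * r ^ (n + 1)) (fun n => by positivity) hsA h0 h1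
  simp only [zero_add, pow_one, Nat.reduceAdd] at hle
  have hu : 0 ≤ 1 - ‖ω 0‖ ^ 2 := by
    nlinarith [hd.norm_zero_le_one, norm_nonneg (ω 0)]
  refine le_trans ?_ (add_le_add_right (mul_le_mul_of_nonneg_left hle hu) _)
  rw [majorant, majorant, ← tsum_mul_left, ← tsum_mul_left,
    ← (hsA.mul_left _).tsum_add (hs.mul_left _)]
  refine (summable_majorant hd.analytic h0 h1).tsum_le_tsum (fun n => ?_)
    ((hsA.mul_left _).add (hs.mul_left _))
  refine (mul_le_mul_of_nonneg_right (hd.norm_taylorCoeff_succ_le hh n)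
    (by positivity : 0 ≤ r ^ (n + 1))).trans_eq ?_
  rw [add_mul, mul_assoc, mul_assoc, Finset.sum_mul]
  congr 2
  refine Finset.sum_congr rfl fun j hj => ?_
  have : r ^ (n + 1) = r ^ (j + 1) * r ^ (n - j) := by
    rw [← pow_add]; congr 1; have := Finset.mem_range.1 hj; omega
  rw [this]; ring

theorem majorant_nonneg (f : ℂ → ℂ) {r : ℝ} (h0 : 0 ≤ r) : 0 ≤ majorant f r :=
  tsum_nonneg fun n => by positivity

theorem normSqR_nonneg (f : ℂ → ℂ) (r : ℝ) : 0 ≤ normSqR f r :=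
  tsum_nonneg fun n => by
    have : 0 ≤ r ^ (2 * (n + 1)) := by rw [pow_mul]; positivity
    positivity

theorem majorant_eq_add_tail {f : ℂ → ℂ} (hf : DifferentiableOn ℂ f (ball 0 1)) {r : ℝ}
    (h0 : 0 ≤ r) (h1 : r < 1) : majorant f r = ‖taylorCoeff f 1‖ * r + ‖taylorCoeff f 2‖ * r ^ 2
      + ∑' n : ℕ, ‖taylorCoeff f (n + 3)‖ * r ^ (n + 3) := by
  rw [majorant, ← (summable_majorant hf h0 h1).sum_add_tsum_nat_add 2]
  simp [Finset.sum_range_succ]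

theorem quadratic_le_of_mem_Icc {r : ℝ} (h0 : 1 / 3 ≤ r) (h1 : r ≤ 1 / 2) :
    1 / 12 + 4 * r ^ 2 - r ≤ ((1 + r ^ 2) * (1 + 3 / 4 * r ^ 2 * (1 + r ^ 2))
      + 2 / 3 * (1 / 12 + 4 * r ^ 2 - r)) * (169 / 400 * (1 - r ^ 2)) := by
  obtain ⟨t, rfl⟩ : ∃ t, r = 1 / 2 - t := ⟨1 / 2 - r, by ring⟩
  have ht0 : 0 ≤ t := by linarith
  have ht1 : t ≤ 1 / 6 := by linarith
  -- Only the term of degree six in r is dropped; what remains is certified by products of odd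
  -- powers of t with 1/6 - t.
  have h3 : 1 + 7 / 4 * (1 / 2 - t) ^ 2 + 3 / 2 * ((1 / 2 - t) ^ 2) ^ 2
      ≤ (1 + (1 / 2 - t) ^ 2) * (1 + 3 / 4 * (1 / 2 - t) ^ 2 * (1 + (1 / 2 - t) ^ 2)) := by
    have : 0 ≤ ((1 / 2 - t) ^ 2) ^ 3 := by positivity
    nlinarith
  have h4 : 0 ≤ 169 / 400 * (1 - (1 / 2 - t) ^ 2) := by nlinarith
  refine le_trans ?_ (mul_le_mul_of_nonneg_right (add_le_add_left h3 _) h4)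
  have e1 := mul_nonneg ht0 (sub_nonneg.2 ht1)
  have e3 := mul_nonneg (pow_nonneg ht0 3) (sub_nonneg.2 ht1)
  have e5 := mul_nonneg (pow_nonneg ht0 5) (sub_nonneg.2 ht1)
  linarith [pow_nonneg ht0 3, pow_nonneg ht0 5]

/-- Here y = r/(1 - r), M = 1 - |h(0)|², α = |a₁|, β = |a₂|, T is the majorant tail from n = 3, and
C is the factor in E. The net coefficient of α is nonpositive, so only β and T must be paid for.
Both are controlled by M - (2/3)α², which is small when α is large, while the surplus Cα² is then
large. -/
theorem weighted_le_of_large_coeff {r y C M α β T : ℝ} (h0 : 1 / 3 ≤ r) (h1 : r ≤ 1 / 2)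
    (hy1 : 1 / 2 ≤ y) (hy2 : y ≤ 2 * r) (hMr : 1 - r ^ 2 ≤ M) (hα : 13 / 20 * M ≤ α)
    (hβ0 : 0 ≤ β) (hβ : β ≤ M - 2 / 3 * α ^ 2) (hT : T ≤ (M - 2 / 3 * α ^ 2) * (r ^ 2 * y))
    (hC : (1 + r ^ 2) * (1 + 3 / 4 * r ^ 2 * (1 + r ^ 2)) ≤ C * (1 - r ^ 2 / 4)) :
    y * (α * r + β * r ^ 2 + T - 2 / 3 * (α * r) - 1 / 2 * (β * r ^ 2)) + α * r * r / 6
        + β * r ^ 2 * r / 6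
      ≤ 1 / 2 * (α * r + β * r ^ 2 + T) + C * (α ^ 2 * (r ^ 2 * (1 - r ^ 2 / 4))) := by
  have hr0 : 0 ≤ r := by linarith
  have hM0 : 0 ≤ M := by nlinarith
  have hα0 : 0 ≤ α := by linarith
  have hpoly := quadratic_le_of_mem_Icc h0 h1
  have hg0 : 0 ≤ 1 / 12 + 4 * r ^ 2 - r := by nlinarith
  have hP0 : 0 ≤ (1 + r ^ 2) * (1 + 3 / 4 * r ^ 2 * (1 + r ^ 2)) := by positivity
  have hN0 : 0 ≤ M - 2 / 3 * α ^ 2 := hβ0.trans hβ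
  have hx : 169 / 400 * (1 - r ^ 2) * M ≤ α ^ 2 := by
    have h5 : (13 / 20 * M) ^ 2 ≤ α ^ 2 := pow_le_pow_left₀ (by positivity) hα 2
    have h6 := mul_le_mul_of_nonneg_right hMr hM0
    linarith
  have hNg : (M - 2 / 3 * α ^ 2) * (1 / 12 + 4 * r ^ 2 - r) ≤ C * (1 - r ^ 2 / 4) * α ^ 2 := by
    have h9 := mul_le_mul_of_nonneg_right hC (sq_nonneg α)
    generalize (1 + r ^ 2) * (1 + 3 / 4 * r ^ 2 * (1 + r ^ 2)) = P at *
    generalize 1 / 12 + 4 * r ^ 2 - r = g at *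
    have h7 := mul_le_mul_of_nonneg_left hpoly hM0
    have h8 := mul_le_mul_of_nonneg_left hx (show 0 ≤ P + 2 / 3 * g by positivity)
    linarith
  have hT' : T * (y - 1 / 2) ≤ (M - 2 / 3 * α ^ 2) * r ^ 2 * (4 * r ^ 2 - r) := by
    have h10 := mul_le_mul_of_nonneg_right hT (show 0 ≤ y - 1 / 2 by linarith)
    have h11 : y * (y - 1 / 2) ≤ 4 * r ^ 2 - r := by nlinarith
    have h12 := mul_le_mul_of_nonneg_left h11 (mul_nonneg hN0 (sq_nonneg r))
    linarith
  have hB : β * r ^ 2 * (y / 2 + r / 6 - 1 / 2) ≤ (M - 2 / 3 * α ^ 2) * r ^ 2 * (1 / 12) := by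
    have h13 : y / 2 + r / 6 - 1 / 2 ≤ 1 / 12 := by linarith
    have h14 := mul_le_mul_of_nonneg_left h13 (show 0 ≤ β * r ^ 2 by positivity)
    have h15 := mul_le_mul_of_nonneg_right hβ (show 0 ≤ r ^ 2 * (1 / 12) by positivity)
    linarith
  have hA : α * r * (y / 3 + r / 6 - 1 / 2) ≤ 0 :=
    mul_nonpos_of_nonneg_of_nonpos (by positivity) (by linarith)
  have hfin := mul_le_mul_of_nonneg_left hNg (sq_nonneg r)
  linarith

/-! ### The bound for G in four cases. -/

namespace HasDilatation

variable {ω h G : ℂ → ℂ}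

/-- Since 1 - |ω(0)| ≥ (1 - |ω(0)|²)/2, gains and losses against h all carry the factor 1 - |ω(0)|².
Removing it leaves a condition on h and r alone. -/
theorem majorant_add_le_of_weighted_le (hd : HasDilatation ω h G) (hh : MemB h) {r : ℝ}
    (h0 : 0 ≤ r) (h1 : r < 1)
    (hw : r / (1 - r) * (majorant h r - 2 / 3 * (‖taylorCoeff h 1‖ * r)
        - 1 / 2 * (‖taylorCoeff h 2‖ * r ^ 2))
        + ‖taylorCoeff h 1‖ * r * r / 6 + ‖taylorCoeff h 2‖ * r ^ 2 * r / 6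
      ≤ 1 / 2 * majorant h r + 1 / (1 + ‖h 0‖) * ((1 + ‖h 0‖ * r) / (1 - r))
        * (‖taylorCoeff h 1‖ ^ 2 * (r ^ 2 * (1 - r ^ 2 / 4)))) :
    majorant G r + 1 / (1 + ‖h 0‖) * ((1 + ‖h 0‖ * r) / (1 - r)) * normSqR G r
      ≤ (1 - ‖h 0‖ ^ 2) * (r / (1 - r)) := by
  have hr : 0 < 1 - r := by linarith
  refine le_trans ?_ (hh.majorant_add_le h0 h1)
  have h2 := hd.majorant_le hh.analytic h0 h1
  have h3 := hd.normSqR_le hh.analytic h0 h1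
  have hw1 := hd.norm_zero_le_one
  have hw0 := norm_nonneg (ω 0)
  have hM := majorant_nonneg h h0
  have hC : 0 ≤ 1 / (1 + ‖h 0‖) * ((1 + ‖h 0‖ * r) / (1 - r)) := by positivity
  set C := 1 / (1 + ‖h 0‖) * ((1 + ‖h 0‖ * r) / (1 - r))
  have hu : 0 ≤ 1 - ‖ω 0‖ ^ 2 := by nlinarith
  have h4 := mul_le_mul_of_nonneg_left hw hu
  have h5 := mul_le_mul_of_nonneg_left h3 hC
  have h6 : (1 - ‖ω 0‖ ^ 2) * (1 / 2 * majorant h r) ≤ (1 - ‖ω 0‖) * majorant h r := by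
    have : (1 - ‖ω 0‖ ^ 2) * (1 / 2) ≤ 1 - ‖ω 0‖ := by nlinarith
    nlinarith
  nlinarith

theorem majorant_add_le_of_le_third (hd : HasDilatation ω h G) (hh : MemB h) {r : ℝ}
    (h0 : 0 ≤ r) (h1 : r ≤ 1 / 3) :
    majorant G r + 1 / (1 + ‖h 0‖) * ((1 + ‖h 0‖ * r) / (1 - r)) * normSqR G r
      ≤ (1 - ‖h 0‖ ^ 2) * (r / (1 - r)) := by
  have hr1 : r < 1 := by linarith
  have hr : 0 < 1 - r := by linarith
  refine hd.majorant_add_le_of_weighted_le hh h0 hr1 ?_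
  -- For r ≤ 1/3 one has r/(1 - r) ≤ 1/2, so half the majorant suffices and this surplus is needed
  -- only to be nonnegative.
  have h2 : 0 ≤ 1 / (1 + ‖h 0‖) * ((1 + ‖h 0‖ * r) / (1 - r))
        * (‖taylorCoeff h 1‖ ^ 2 * (r ^ 2 * (1 - r ^ 2 / 4))) := by
    have : 0 ≤ 1 - r ^ 2 / 4 := by nlinarith
    positivity
  have hy : r / (1 - r) ≤ 1 / 2 := by rw [div_le_iff₀ hr]; linarith
  have hM := majorant_eq_add_tail hh.analytic h0 hr1
  have ht : 0 ≤ ∑' n : ℕ, ‖taylorCoeff h (n + 3)‖ * r ^ (n + 3) := tsum_nonneg fun n => by positivity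
  have hA : 0 ≤ ‖taylorCoeff h 1‖ * r := by positivity
  have hB : 0 ≤ ‖taylorCoeff h 2‖ * r ^ 2 := by positivity
  set A := ‖taylorCoeff h 1‖ * r
  set B := ‖taylorCoeff h 2‖ * r ^ 2
  have h3 := mul_le_mul_of_nonneg_right hy
    (show 0 ≤ majorant h r - 2 / 3 * A - 1 / 2 * B by linarith)
  nlinarith

theorem majorant_add_le_of_large_coeff (hd : HasDilatation ω h G) (hh : MemB h) {r : ℝ}
    (h0 : 1 / 3 ≤ r) (h1 : r ≤ 1 / 2) (har : ‖h 0‖ ≤ r)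
    (hα : 13 / 20 * (1 - ‖h 0‖ ^ 2) ≤ ‖taylorCoeff h 1‖) :
    majorant G r + 1 / (1 + ‖h 0‖) * ((1 + ‖h 0‖ * r) / (1 - r)) * normSqR G r
      ≤ (1 - ‖h 0‖ ^ 2) * (r / (1 - r)) := by
  have hr1 : r < 1 := by linarith
  have hr0 : 0 ≤ r := by linarith
  have hr : 0 < 1 - r := by linarith
  refine hd.majorant_add_le_of_weighted_le hh hr0 hr1 ?_
  have hM := majorant_eq_add_tail hh.analytic hr0 hr1
  have hα0 : 0 ≤ ‖taylorCoeff h 1‖ := norm_nonneg _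
  have ha0 : 0 ≤ ‖h 0‖ := norm_nonneg _
  have hβ : ‖taylorCoeff h 2‖
      ≤ 1 - ‖h 0‖ ^ 2 - 2 / 3 * ‖taylorCoeff h 1‖ ^ 2 := by
    have h2 := hh.norm_taylorCoeff_even_le (k := 1) le_rfl
    simp only [Finset.sum_range_one, taylorCoeff_zero, mul_one] at h2
    have h3 : 2 / 3 * ‖taylorCoeff h 1‖ ^ 2 ≤ ‖taylorCoeff h 1‖ ^ 2 / (1 + ‖h 0‖) := by
      rw [le_div_iff₀ (by positivity)]
      nlinarith [sq_nonneg ‖taylorCoeff h 1‖]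
    linarith
  have hcoeff : ∀ n : ℕ, ‖taylorCoeff h (n + 3)‖
      ≤ 1 - ‖h 0‖ ^ 2 - 2 / 3 * ‖taylorCoeff h 1‖ ^ 2 := by
    intro n
    have hfirst : ∀ k, 2 ≤ k → ‖h 0‖ ^ 2 + ‖taylorCoeff h 1‖ ^ 2
        ≤ ∑ i ∈ Finset.range k, ‖taylorCoeff h i‖ ^ 2 := by
      intro k hk
      have : ∑ i ∈ Finset.range 2, ‖taylorCoeff h i‖ ^ 2
          ≤ ∑ i ∈ Finset.range k, ‖taylorCoeff h i‖ ^ 2 :=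
        Finset.sum_le_sum_of_subset_of_nonneg (Finset.range_mono hk) fun _ _ _ => by positivity
      rwa [Finset.sum_range_succ, Finset.sum_range_one, taylorCoeff_zero] at this
    have hsq := sq_nonneg ‖taylorCoeff h 1‖
    rcases Nat.even_or_odd' (n + 3) with ⟨k, hk | hk⟩
    · have h2 := hh.norm_taylorCoeff_even_le (k := k) (by omega)
      have h3 : 0 ≤ ‖taylorCoeff h k‖ ^ 2 / (1 + ‖h 0‖) := by positivity
      rw [hk]
      linarith [hfirst k (by omega)]
    · have h2 := hh.norm_taylorCoeff_odd_le (k := k + 1) (by omega)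
      rw [show 2 * (k + 1) - 1 = n + 3 by omega] at h2
      linarith [hfirst (k + 1) (by omega)]
  have ht : ∑' n : ℕ, ‖taylorCoeff h (n + 3)‖ * r ^ (n + 3)
      ≤ (1 - ‖h 0‖ ^ 2 - 2 / 3 * ‖taylorCoeff h 1‖ ^ 2) * (r ^ 2 * (r / (1 - r))) := by
    have hg := ((hasSum_geometric_of_lt_one hr0 hr1).mul_left
      ((1 - ‖h 0‖ ^ 2 - 2 / 3 * ‖taylorCoeff h 1‖ ^ 2) * r ^ 3))
    refine (Summable.tsum_le_tsum (fun n => ?_)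
      ((summable_nat_add_iff 2).2 (summable_majorant hh.analytic hr0 hr1)) hg.summable).trans_eq ?_
    · refine (mul_le_mul_of_nonneg_right (hcoeff n) (by positivity)).trans_eq ?_
      ring
    · rw [hg.tsum_eq]; field_simp
  have hC : (1 + r ^ 2) * (1 + 3 / 4 * r ^ 2 * (1 + r ^ 2))
      ≤ 1 / (1 + ‖h 0‖) * ((1 + ‖h 0‖ * r) / (1 - r)) * (1 - r ^ 2 / 4) := by
    have hr2 : 0 < 1 - r ^ 2 := by nlinarith
    -- The factor decreases in |h(0)|, so its least value under |h(0)| ≤ r is at |h(0)| = r.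
    have e1 : (1 + r ^ 2) / (1 - r ^ 2) ≤ 1 / (1 + ‖h 0‖) * ((1 + ‖h 0‖ * r) / (1 - r)) := by
      rw [div_mul_div_comm, one_mul, div_le_div_iff₀ hr2 (by positivity)]
      nlinarith [mul_nonneg (mul_nonneg hr.le hr.le) (sub_nonneg.2 har)]
    refine le_trans ?_ (mul_le_mul_of_nonneg_right e1 (by nlinarith))
    rw [div_mul_eq_mul_div (1 + r ^ 2), le_div_iff₀ hr2, mul_assoc]
    refine mul_le_mul_of_nonneg_left ?_ (by positivity)
    nlinarith [pow_nonneg hr0 6]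
  have hy1 : 1 / 2 ≤ r / (1 - r) := by rw [le_div_iff₀ hr]; linarith
  have hy2 : r / (1 - r) ≤ 2 * r := by rw [div_le_iff₀ hr]; nlinarith
  have hMr : 1 - r ^ 2 ≤ 1 - ‖h 0‖ ^ 2 := by nlinarith
  have := weighted_le_of_large_coeff h0 h1 hy1 hy2 hMr hα (norm_nonneg _) hβ ht hC
  rw [hM]
  linarith

/-- The first coefficient is split off and the tail estimated by square sums. The threshold 13/20
still works at r = 1/2, where the final sum is about 0.995. -/
theorem majorant_add_le_of_small_coeff (hd : HasDilatation ω h G) (hh : MemB h) {r : ℝ}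
    (h0 : 0 < r) (h1 : r ≤ 1 / 2) (har : ‖h 0‖ ≤ r)
    (hα : ‖taylorCoeff h 1‖ ≤ 13 / 20 * (1 - ‖h 0‖ ^ 2)) :
    majorant G r + 1 / (1 + ‖h 0‖) * ((1 + ‖h 0‖ * r) / (1 - r)) * normSqR G r
      ≤ (1 - ‖h 0‖ ^ 2) * (r / (1 - r)) := by
  have hr1 : r < 1 := by linarith
  have hr : 0 < 1 - r := by linarith
  have hr2 : 0 < 1 - r ^ 2 := by nlinarith
  have ha0 : 0 ≤ ‖h 0‖ := norm_nonneg _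
  have hβ : ‖taylorCoeff G 1‖ ≤ 13 / 20 * (1 - ‖h 0‖ ^ 2) := by
    rw [hd.norm_taylorCoeff_one hh.analytic]
    exact (mul_le_of_le_one_left (norm_nonneg _) hd.norm_zero_le_one).trans hα
  have hβ0 : 0 ≤ ‖taylorCoeff G 1‖ := norm_nonneg _
  have hMr : 1 - r ^ 2 ≤ 1 - ‖h 0‖ ^ 2 := by nlinarith
  have hM1 : 1 - ‖h 0‖ ^ 2 ≤ 1 := by nlinarith
  have htail : ∀ N : ℕ, ∑ n ∈ Finset.range N, ‖taylorCoeff G (n + 1 + 1)‖ ^ 2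
      ≤ 1 - ‖h 0‖ ^ 2 := by
    intro N
    refine le_trans ?_ (hd.sum_sq_norm_le hh (N + 1))
    rw [Finset.sum_range_succ' _ N]
    exact le_add_of_nonneg_right (by positivity)
  set M := 1 - ‖h 0‖ ^ 2
  set b := ‖taylorCoeff G 1‖
  set l := r ^ 2 / (1 - r ^ 2) with hl
  have hl0 : 0 < l := by positivity
  have hmaj : majorant G r ≤ b * r + M * l := by
    refine (summable_majorant hd.analytic h0.le hr1).tsum_le_of_sum_range_le fun N => ?_
    refine (Finset.sum_le_sum_of_subset_of_nonneg (Finset.range_mono (Nat.le_succ N))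
      fun _ _ _ => by positivity).trans ?_
    rw [Finset.sum_range_succ', add_comm]
    simp only [zero_add, pow_one]
    refine add_le_add_right ?_ _
    -- Weighted AM–GM. With this l the two halves sum to l(M + 1 - r²)/2, at most lM because 1 - r²
    -- ≤ M.
    have hterm : ∀ n ∈ Finset.range N, ‖taylorCoeff G (n + 1 + 1)‖ * r ^ (n + 1 + 1)
        ≤ l / 2 * ‖taylorCoeff G (n + 1 + 1)‖ ^ 2 + r ^ 4 / (2 * l) * (r ^ 2) ^ n := by
      intro n _
      have e : r ^ 4 / (2 * l) * (r ^ 2) ^ n = (r ^ (n + 1 + 1)) ^ 2 / (2 * l) := by ring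
      rw [e]
      have h3 := sq_nonneg (l * ‖taylorCoeff G (n + 1 + 1)‖ - r ^ (n + 1 + 1))
      have h4 : l / 2 * ‖taylorCoeff G (n + 1 + 1)‖ ^ 2 + (r ^ (n + 1 + 1)) ^ 2 / (2 * l)
          - ‖taylorCoeff G (n + 1 + 1)‖ * r ^ (n + 1 + 1)
          = (l * ‖taylorCoeff G (n + 1 + 1)‖ - r ^ (n + 1 + 1)) ^ 2 / (2 * l) := by
        field_simp
        ring
      have h5 : 0 ≤ (l * ‖taylorCoeff G (n + 1 + 1)‖ - r ^ (n + 1 + 1)) ^ 2 / (2 * l) := by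
        positivity
      linarith
    refine (Finset.sum_le_sum hterm).trans ?_
    rw [Finset.sum_add_distrib, ← Finset.mul_sum, ← Finset.mul_sum]
    have hgeo : ∑ n ∈ Finset.range N, (r ^ 2) ^ n ≤ 1 / (1 - r ^ 2) := by
      have hgs := hasSum_geometric_of_lt_one (sq_nonneg r) (by linarith : r ^ 2 < 1)
      rw [one_div, ← hgs.tsum_eq]
      exact hgs.summable.sum_le_tsum _ fun _ _ => by positivity
    have h6 := mul_le_mul_of_nonneg_left (htail N) (half_pos hl0).le
    have h7 := mul_le_mul_of_nonneg_left hgeo (show 0 ≤ r ^ 4 / (2 * l) by positivity)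
    have h8 : r ^ 4 / (2 * l) * (1 / (1 - r ^ 2)) = l * (1 - r ^ 2) / 2 := by
      rw [hl]; field_simp
    have h9 := mul_le_mul_of_nonneg_left hMr hl0.le
    nlinarith
  have hsq : normSqR G r ≤ b ^ 2 * r ^ 2 + M * r ^ 4 := by
    refine (summable_normSqR hd.analytic h0.le hr1).tsum_le_of_sum_range_le fun N => ?_
    refine (Finset.sum_le_sum_of_subset_of_nonneg (Finset.range_mono (Nat.le_succ N))
      fun _ _ _ => by positivity).trans ?_
    rw [Finset.sum_range_succ', add_comm]
    simp only [zero_add, mul_one]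
    refine add_le_add_right ?_ _
    refine le_trans ?_ (mul_le_mul_of_nonneg_right (htail N) (by positivity : 0 ≤ r ^ 4))
    rw [Finset.sum_mul]
    refine Finset.sum_le_sum fun n _ => mul_le_mul_of_nonneg_left ?_ (by positivity)
    exact pow_le_pow_of_le_one h0.le hr1.le (by omega)
  have hC0 : 0 ≤ 1 / (1 + ‖h 0‖) * ((1 + ‖h 0‖ * r) / (1 - r)) := by positivity
  have hC1 : 1 / (1 + ‖h 0‖) * ((1 + ‖h 0‖ * r) / (1 - r)) ≤ 1 / (1 - r) := by
    rw [div_mul_div_comm, one_mul, div_le_div_iff₀ (by positivity) hr]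
    nlinarith [mul_nonneg ha0 hr.le]
  have hM0 : 0 < M := by linarith
  have hb2 : b ^ 2 ≤ 169 / 400 * M := by
    have := pow_le_pow_left₀ hβ0 hβ 2
    nlinarith
  have h10 : 1 / (1 + ‖h 0‖) * ((1 + ‖h 0‖ * r) / (1 - r)) * normSqR G r
      ≤ 1 / (1 - r) * (169 / 400 * M * r ^ 2 + M * r ^ 4) := by
    refine (mul_le_mul_of_nonneg_left hsq hC0).trans
      (mul_le_mul hC1 ?_ (by positivity) (by positivity))
    nlinarith [sq_nonneg r]
  have h11 : b * r ≤ 13 / 20 * M * r := mul_le_mul_of_nonneg_right hβ h0.le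
  have hpoly : 13 / 20 * (1 - r) + (1 / 3 + 4 / 9 * (r - 1 / 2)) + 169 / 400 * r + r ^ 3 ≤ 1 := by
    nlinarith
  -- Tangent line of the concave function r/(1 + r) at r = 1/2.
  have hfrac : r / (1 + r) ≤ 1 / 3 + 4 / 9 * (r - 1 / 2) := by
    rw [div_le_iff₀ (by positivity)]
    nlinarith [sq_nonneg (r - 1 / 2)]
  have hl2 : l = r / (1 - r) * (r / (1 + r)) := by
    have : 1 + r ≠ 0 := by positivity
    rw [hl, show 1 - r ^ 2 = (1 - r) * (1 + r) by ring]; field_simp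
  have hsum : b * r + M * l + 1 / (1 - r) * (169 / 400 * M * r ^ 2 + M * r ^ 4)
      ≤ M * (r / (1 - r)) * (13 / 20 * (1 - r) + r / (1 + r) + 169 / 400 * r + r ^ 3) := by
    refine (add_le_add_left (add_le_add_left h11 _) _).trans_eq ?_
    rw [hl2]; field_simp; ring
  have hlast := mul_le_mul_of_nonneg_left
    (show 13 / 20 * (1 - r) + r / (1 + r) + 169 / 400 * r + r ^ 3 ≤ 1 by linarith)
    (show 0 ≤ M * (r / (1 - r)) by positivity)
  linarith

/-- Splitting |b_n|r^n as (|b_n|s^n)(ar)^{n/2} with s² = r/a, legitimate since r < a, is the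
Cauchy–Schwarz split that is sharp for Möbius maps. The two resulting bounds add up exactly to the
right-hand side. -/
theorem majorant_add_le_of_lt_norm_zero (hd : HasDilatation ω h G) (hh : MemB h)
    (hlt : ‖h 0‖ < 1) {r : ℝ} (h0 : 0 ≤ r) (har : r < ‖h 0‖) :
    majorant G r + 1 / (1 + ‖h 0‖) * ((1 + ‖h 0‖ * r) / (1 - r)) * normSqR G r
      ≤ (1 - ‖h 0‖ ^ 2) * (r / (1 - r)) := by
  have hr1 : r < 1 := har.trans hlt
  have hr : 0 < 1 - r := by linarith
  have ha : 0 < ‖h 0‖ := h0.trans_lt har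
  have hsq : ∀ s : ℝ, 0 ≤ s → s < 1 → normSqR G s ≤ normSqR h s := by
    intro s hs0 hs1
    have h3 := hd.normSqR_le hh.analytic hs0 hs1
    have h4 : 0 ≤ (1 - ‖ω 0‖ ^ 2) * (‖taylorCoeff h 1‖ ^ 2 * (s ^ 2 * (1 - s ^ 2 / 4))) := by
      have h5 : 0 ≤ 1 - ‖ω 0‖ ^ 2 := by nlinarith [hd.norm_zero_le_one, norm_nonneg (ω 0)]
      have h6 : 0 ≤ 1 - s ^ 2 / 4 := by nlinarith
      positivity
    linarith
  set a := ‖h 0‖ with ha_def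
  have hM : 0 < 1 - a ^ 2 := by nlinarith
  have har1 : 0 < 1 - a * r := by nlinarith
  set s := Real.sqrt (r / a) with hs
  have hs2 : s ^ 2 = r / a := Real.sq_sqrt (by positivity)
  have hs0 : 0 ≤ s := Real.sqrt_nonneg _
  have hs1 : s < 1 := by
    have : r / a < 1 := (div_lt_one ha).2 har
    nlinarith
  have hGs : normSqR G s ≤ (1 - a ^ 2) ^ 2 * (r / a) / (1 - a * r) := by
    refine (hsq s hs0 hs1).trans ?_
    rw [le_div_iff₀ har1]
    have h3 := hh.normSqR_mul_le hlt hs0 hs1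
    rw [hs2] at h3
    have e : 1 - ‖h 0‖ ^ 2 * (r / a) = 1 - a * r := by rw [← ha_def]; field_simp
    rwa [e] at h3
  have hmaj : majorant G r ≤ (1 - a ^ 2) * r / (1 - a * r) := by
    have hgs := (hasSum_geometric_of_lt_one (show 0 ≤ a * r by positivity)
      (by linarith : a * r < 1)).mul_left (a * r)
    have hsum := ((summable_normSqR hd.analytic hs0 hs1).mul_left (a / (2 * (1 - a ^ 2)))).hasSum.add
      (hgs.mul_left ((1 - a ^ 2) / (2 * a)))
    refine ((summable_majorant hd.analytic h0 hr1).tsum_le_tsum (fun n => ?_) hsum.summable).trans ?_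
    · rw [pow_mul, hs2]
      have e1 : a * r * (a * r) ^ n = a ^ (n + 1) * r ^ (n + 1) := by ring
      have e2 : (r / a) ^ (n + 1) = r ^ (n + 1) / a ^ (n + 1) := div_pow _ _ _
      rw [e1, e2]
      set R := r ^ (n + 1)
      set P := a ^ (n + 1)
      set t := ‖taylorCoeff G (n + 1)‖
      have hR : 0 ≤ R := by positivity
      have hP : 0 < P := by positivity
      have e3 : a / (2 * (1 - a ^ 2)) * (t ^ 2 * (R / P)) + (1 - a ^ 2) / (2 * a) * (P * R) - t * R
          = R * (a * t - (1 - a ^ 2) * P) ^ 2 / (2 * a * (1 - a ^ 2) * P) := by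
        have hM' := hM.ne'
        field_simp
        ring
      have h4 : 0 ≤ R * (a * t - (1 - a ^ 2) * P) ^ 2 / (2 * a * (1 - a ^ 2) * P) := by positivity
      linarith
    · rw [hsum.tsum_eq, tsum_mul_left]
      have h5 := mul_le_mul_of_nonneg_left hGs (show 0 ≤ a / (2 * (1 - a ^ 2)) by positivity)
      refine (add_le_add_left h5 _).trans_eq ?_
      have hM' := hM.ne'
      have har' := har1.ne'
      field_simp
      ring
  have hNr : normSqR G r ≤ (1 - a ^ 2) ^ 2 * r ^ 2 / (1 - a ^ 2 * r ^ 2) := by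
    refine (hsq r h0 hr1).trans ?_
    rw [le_div_iff₀ (by nlinarith)]
    exact hh.normSqR_mul_le hlt h0 hr1
  have hC0 : 0 ≤ 1 / (1 + a) * ((1 + a * r) / (1 - r)) := by positivity
  refine (add_le_add hmaj (mul_le_mul_of_nonneg_left hNr hC0)).trans_eq ?_
  rw [show 1 - a ^ 2 * r ^ 2 = (1 - a * r) * (1 + a * r) by ring]
  have har2 : 1 + a * r ≠ 0 := by positivity
  field_simp
  ring

theorem majorant_add_le (hd : HasDilatation ω h G) (hh : MemB h) (hlt : ‖h 0‖ < 1) {r : ℝ}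
    (h0 : 0 ≤ r) (h1 : r ≤ 1 / 2) :
    majorant G r + 1 / (1 + ‖h 0‖) * ((1 + ‖h 0‖ * r) / (1 - r)) * normSqR G r
      ≤ (1 - ‖h 0‖ ^ 2) * (r / (1 - r)) := by
  rcases le_total r (1 / 3) with h3 | h3
  · exact hd.majorant_add_le_of_le_third hh h0 h3
  rcases lt_or_ge r ‖h 0‖ with har | har
  · exact hd.majorant_add_le_of_lt_norm_zero hh hlt h0 har
  rcases le_total ‖taylorCoeff h 1‖ (13 / 20 * (1 - ‖h 0‖ ^ 2)) with hα | hα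
  · exact hd.majorant_add_le_of_small_coeff hh (by linarith) h1 har hα
  · exact hd.majorant_add_le_of_large_coeff hh h3 h1 har hα

end HasDilatation

/-! ### The bound for E_f. -/

theorem taylorCoeff_const_mul {f : ℂ → ℂ} (c : ℂ) (n : ℕ) :
    taylorCoeff (fun z => c * f z) n = c * taylorCoeff f n := by
  rw [taylorCoeff, taylorCoeff, iteratedDeriv_const_mul_field, mul_div_assoc]

theorem majorant_const_mul (f : ℂ → ℂ) (c : ℂ) (r : ℝ) :
    majorant (fun z => c * f z) r = ‖c‖ * majorant f r := by
  simp only [majorant, taylorCoeff_const_mul, norm_mul, mul_assoc, tsum_mul_left]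

theorem normSqR_const_mul (f : ℂ → ℂ) (c : ℂ) (r : ℝ) :
    normSqR (fun z => c * f z) r = ‖c‖ ^ 2 * normSqR f r := by
  simp only [normSqR, taylorCoeff_const_mul, norm_mul, mul_pow, mul_assoc, tsum_mul_left]

theorem majorant_of_eq_zero {g : ℂ → ℂ} (hg : ∀ z ∈ ball (0 : ℂ) 1, g z = 0) (r : ℝ) :
    majorant g r = 0 := by
  have h0 : ∀ n, taylorCoeff g n = 0 := fun n => by
    rw [taylorCoeff_congr (g := fun _ => 0) hg, taylorCoeff]
    simp
  simp [majorant, h0]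

/-- The bound `E_f(k, r) ≤ (1 + k)(1 - |a₀|²) r / (1 - r)` for `r ≤ 1/2`. -/
theorem MemHk.EFun_le {k : ℝ} {h g : ℂ → ℂ} (hf : MemHk k h g) (hn : NonconstantOnDisk h)
    (hk : 0 ≤ k) {r : ℝ} (h0 : 0 ≤ r) (h1 : r ≤ 1 / 2) :
    EFun k h g r ≤ (1 + k) * ((1 - ‖h 0‖ ^ 2) * (r / (1 - r))) := by
  have hlt := hf.memB.norm_zero_lt hn
  have hH := hf.memB.majorant_add_le h0 (by linarith)
  rcases hk.eq_or_lt with rfl | hk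
  · have hg : ∀ z ∈ ball (0 : ℂ) 1, g z = 0 := by
      intro z hz
      rw [← hf.map_zero]
      refine isOpen_ball.is_const_of_deriv_eq_zero (convex_ball 0 1).isPreconnected hf.analytic
        (fun w hw => ?_) hz (mem_ball_self one_pos)
      have := hf.deriv_le w hw
      rw [zero_mul] at this
      exact norm_le_zero_iff.1 this
    rw [EFun, cFun, if_pos rfl, majorant_of_eq_zero hg]
    linarith
  · set G : ℂ → ℂ := fun z => ((k⁻¹ : ℝ) : ℂ) * g z with hG
    have hGd : DifferentiableOn ℂ G (ball 0 1) := hf.analytic.const_mul _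
    have hle : ∀ z ∈ ball (0 : ℂ) 1, ‖deriv G z‖ ≤ ‖deriv h z‖ := by
      intro z hz
      rw [hG, deriv_const_mul _ (hf.analytic.differentiableAt (isOpen_ball.mem_nhds hz)), norm_mul,
        Complex.norm_real, Real.norm_of_nonneg (by positivity), inv_mul_le_iff₀ hk]
      exact hf.deriv_le z hz
    obtain ⟨ω, hd⟩ := exists_hasDilatation hf.memB.analytic hn hGd hle
    have hGle := hd.majorant_add_le hf.memB hlt h0 h1
    have hgG : g = fun z => ((k : ℝ) : ℂ) * G z := by
      funext z
      have : (k : ℂ) ≠ 0 := by exact_mod_cast hk.ne'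
      simp only [hG]; push_cast; field_simp
    rw [EFun, cFun, if_neg hk.ne']
    have e1 : majorant g r = k * majorant G r := by
      conv_lhs => rw [hgG]
      rw [majorant_const_mul, Complex.norm_real, Real.norm_of_nonneg hk.le]
    have e2 : 1 / k * normSqR g r = k * normSqR G r := by
      conv_lhs => rw [hgG]
      rw [normSqR_const_mul, Complex.norm_real, Real.norm_of_nonneg hk.le]
      field_simp
    rw [e1, e2]
    have h3 := mul_le_mul_of_nonneg_left hGle hk.le
    linarith

/-! ### The root of `lam` and the Bohr-type inequality. -/

theorem strictMonoOn_lam {m : ℕ} {k p : ℝ} (hk : 0 ≤ k) (hp : 0 < p) :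
    StrictMonoOn (lam m k p) (Icc 0 1) := by
  intro x hx y hy hxy
  have hpow : x ^ m ≤ y ^ m := pow_le_pow_left₀ hx.1 hxy.le m
  have hx0 : 0 ≤ x ^ m := pow_nonneg hx.1 m
  have hy1 : y ^ m ≤ 1 := pow_le_one₀ hy.1 hy.2
  have h1 : x * (1 + x ^ m) < y * (1 + y ^ m) := by nlinarith [hx.1]
  have h2 : (1 - y) * (1 - y ^ m) ≤ (1 - x) * (1 - x ^ m) :=
    mul_le_mul (by linarith) (by linarith) (by linarith) (by linarith [hx.1, hxy, hy.2])
  have h3 := mul_lt_mul_of_pos_left h1 (show 0 < 2 * (1 + k) by positivity)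
  have h4 := mul_le_mul_of_nonneg_left h2 hp.le
  simp only [lam]
  linarith

theorem existsUnique_lam_eq_zero {m : ℕ} {k p : ℝ} (hm : 1 ≤ m) (hk : 0 ≤ k) (hp : 0 < p) :
    ∃! R : ℝ, R ∈ Ioo (0 : ℝ) 1 ∧ lam m k p R = 0 := by
  have hm0 : m ≠ 0 := by omega
  have hc : ContinuousOn (lam m k p) (Icc 0 1) := by
    unfold lam
    fun_prop
  have hl : lam m k p 0 < 0 := by simp [lam, hm0, hp]
  have hr : 0 < lam m k p 1 := by simp [lam]; linarith
  obtain ⟨R, hR, hR0⟩ := intermediate_value_Ioo zero_le_one hc ⟨hl, hr⟩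
  refine ⟨R, ⟨hR, hR0⟩, fun S hS => ?_⟩
  exact (strictMonoOn_lam hk hp).injOn (Ioo_subset_Icc_self hS.1) (Ioo_subset_Icc_self hR)
    (hS.2.trans hR0.symm)

/-- Bernoulli's inequality for t² with exponent p/2 ≤ 1; this is where p ≤ 2 enters. -/
theorem rpow_le_one_sub {t p : ℝ} (ht : 0 ≤ t) (hp0 : 0 < p) (hp2 : p ≤ 2) :
    t ^ p ≤ 1 - p / 2 * (1 - t ^ 2) := by
  have h := rpow_one_add_le_one_add_mul_self (s := t ^ 2 - 1) (by nlinarith [sq_nonneg t])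
    (p := p / 2) (by positivity) (by linarith)
  have e : (1 + (t ^ 2 - 1)) ^ (p / 2) = t ^ p := by
    rw [add_sub_cancel, ← Real.rpow_natCast, ← Real.rpow_mul ht]
    congr 1
    push_cast; ring
  rw [e] at h
  linarith

/-- The Bohr-type inequality up to the root of `lam`, without side conditions. -/
theorem MemHk.FFun_le_one {m : ℕ} {k p : ℝ} (hm : 1 ≤ m) (hk : 0 ≤ k) (hp0 : 0 < p) (hp2 : p ≤ 2)
    {h g : ℂ → ℂ} (hf : MemHk k h g) (hn : NonconstantOnDisk h) {z : ℂ} (hz : ‖z‖ < 1)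
    (hl : lam m k p ‖z‖ ≤ 0) : FFun m k p h g z ≤ 1 := by
  have hlt := hf.memB.norm_zero_lt hn
  set r := ‖z‖ with hr
  have hr0 : 0 ≤ r := norm_nonneg _
  have hr1 : 0 < 1 - r := by linarith
  have hρ : ‖z ^ m‖ = r ^ m := norm_pow z m
  have hρ0 : 0 ≤ r ^ m := pow_nonneg hr0 m
  have hρ1 : r ^ m < 1 := pow_lt_one₀ hr0 hz (by omega)
  have ht := hf.memB.norm_le_div hlt (z := z ^ m) (by rw [hρ]; exact hρ1)
  rw [hρ] at ht
  rw [lam] at hl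
  set ρ := r ^ m
  -- The sign condition gives 2r ≤ 2(1 + k)r(1 + ρ) ≤ p(1 - r)(1 - ρ) ≤ 2(1 - r).
  have hhalf : r ≤ 1 / 2 := by
    have h3 : 2 * (r * 1) ≤ 2 * (1 + k) * r * (1 + ρ) := by
      have : r * 1 ≤ (1 + k) * r * (1 + ρ) := by
        have h5 : 0 ≤ k * r := mul_nonneg hk hr0
        have h6 : 0 ≤ (1 + k) * r * ρ := by positivity
        linarith
      linarith
    have h4 : p * (1 - r) * (1 - ρ) ≤ 2 * (1 - r) := by
      have h5 : p * (1 - r) ≤ 2 * (1 - r) := mul_le_mul_of_nonneg_right hp2 hr1.le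
      have h6 : 0 ≤ p * (1 - r) * ρ := by positivity
      linarith
    linarith
  have hE := hf.EFun_le hn hk hr0 hhalf
  have ht0 : 0 ≤ ‖h (z ^ m)‖ := norm_nonneg _
  have hpw := rpow_le_one_sub ht0 hp0 hp2
  set t := ‖h (z ^ m)‖
  set a := ‖h 0‖
  have ha0 : 0 ≤ a := norm_nonneg _
  have hM : 0 ≤ 1 - a ^ 2 := by nlinarith
  have haρ : 0 < 1 + a * ρ := by positivity
  have hq : (1 - a ^ 2) * ((1 - ρ) / (1 + ρ)) ≤ 1 - t ^ 2 := by
    have h3 : t ^ 2 ≤ ((a + ρ) / (1 + a * ρ)) ^ 2 := pow_le_pow_left₀ ht0 ht 2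
    have h4 : 1 - ((a + ρ) / (1 + a * ρ)) ^ 2
        = (1 - a ^ 2) * ((1 - ρ) * (1 + ρ) / (1 + a * ρ) ^ 2) := by
      field_simp; ring
    have h5 : (1 - ρ) / (1 + ρ) ≤ (1 - ρ) * (1 + ρ) / (1 + a * ρ) ^ 2 := by
      rw [div_le_div_iff₀ (by positivity) (by positivity), mul_assoc]
      refine mul_le_mul_of_nonneg_left ?_ (by linarith)
      rw [← sq]
      exact pow_le_pow_left₀ haρ.le (by nlinarith) 2
    have := mul_le_mul_of_nonneg_left h5 hM
    linarith
  have hlam : (1 + k) * (r / (1 - r)) ≤ p / 2 * ((1 - ρ) / (1 + ρ)) := by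
    rw [mul_div_assoc', mul_div_assoc', div_le_div_iff₀ hr1 (by positivity)]
    linarith
  have h6 := mul_le_mul_of_nonneg_left hlam hM
  have h7 := mul_le_mul_of_nonneg_left hq (show 0 ≤ p / 2 by positivity)
  rw [FFun]
  linarith

/-! ### Sharpness. -/

theorem norm_sub_le_majorant {f : ℂ → ℂ} (hf : DifferentiableOn ℂ f (ball 0 1)) {z : ℂ}
    (hz : ‖z‖ < 1) : ‖f z - f 0‖ ≤ majorant f ‖z‖ := by
  have hS := (hasSum_nat_add_iff' 1).2 (hasSum_taylorCoeff hf hz)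
  simp only [Finset.sum_range_one, pow_zero, mul_one, taylorCoeff_zero] at hS
  rw [← hS.tsum_eq]
  have hs := summable_majorant hf (norm_nonneg z) hz
  refine (norm_tsum_le_tsum_norm ?_).trans_eq ?_
  · simpa using hs
  · simp [majorant]

theorem one_sub_mul_div_le_rpow {t p : ℝ} (ht : 0 < t) (hp : 0 ≤ p) :
    1 - p * ((1 - t) / t) ≤ t ^ p := by
  have h1 := Real.one_sub_inv_le_log_of_pos ht
  have h2 := Real.add_one_le_exp (Real.log t * p)
  rw [Real.rpow_def_of_pos ht]
  have h3 : (1 - t) / t = t⁻¹ - 1 := by field_simp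
  rw [h3]
  nlinarith [mul_le_mul_of_nonneg_right h1 hp]

/-- The Möbius map `z ↦ (a + z) / (1 + a z)`. -/
noncomputable def moebius (a : ℝ) (z : ℂ) : ℂ := (a + z) / (1 + a * z)

section moebius

variable {a : ℝ}

theorem one_add_mul_ne_zero (h0 : 0 < a) (h1 : a < 1) {z : ℂ} (hz : z ∈ ball (0 : ℂ) 1) :
    1 + (a : ℂ) * z ≠ 0 := by
  intro h
  have h2 : ‖(a : ℂ) * z‖ < 1 := by
    rw [norm_mul, Complex.norm_real, Real.norm_of_nonneg h0.le]
    exact mul_lt_one_of_nonneg_of_lt_one_left h0.le h1 (mem_ball_zero_iff.1 hz).le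
  rw [eq_neg_of_add_eq_zero_right h] at h2
  simp at h2

theorem memB_moebius (h0 : 0 < a) (h1 : a < 1) : MemB (moebius a) where
  analytic := by
    unfold moebius
    refine DifferentiableOn.div (by fun_prop) (by fun_prop) fun z hz => ?_
    exact one_add_mul_ne_zero h0 h1 hz
  bounded := by
    intro z hz
    rw [moebius, norm_div]
    refine div_le_one_of_le₀ (le_of_sq_le_sq ?_ (norm_nonneg _)) (norm_nonneg _)
    have hz2 : ‖z‖ ^ 2 ≤ 1 := pow_le_one₀ (norm_nonneg _) (mem_ball_zero_iff.1 hz).le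
    have hid : ‖1 + (a : ℂ) * z‖ ^ 2 - ‖(a : ℂ) + z‖ ^ 2 = (1 - a ^ 2) * (1 - ‖z‖ ^ 2) := by
      simp only [Complex.sq_norm, Complex.normSq_apply]
      simp
      ring
    have : 0 ≤ (1 - a ^ 2) * (1 - ‖z‖ ^ 2) := mul_nonneg (by nlinarith) (by linarith)
    linarith

theorem moebius_zero : moebius a 0 = a := by simp [moebius]

theorem norm_moebius_sub (h0 : 0 < a) (h1 : a < 1) {r : ℝ} (hr0 : 0 ≤ r) (hr1 : r < 1) :
    ‖moebius a (-r) - moebius a 0‖ = (1 - a ^ 2) * (r / (1 - a * r)) := by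
  have h2 : 0 < 1 - a * r := by nlinarith
  have h3 : moebius a (-r) - moebius a 0 = ((-((1 - a ^ 2) * (r / (1 - a * r))) : ℝ) : ℂ) := by
    have : (1 : ℂ) + a * -r ≠ 0 := by
      have : ((1 - a * r : ℝ) : ℂ) ≠ 0 := by exact_mod_cast h2.ne'
      push_cast at this
      intro h; apply this; rw [← h]; ring
    have h4 : (1 : ℂ) - a * r ≠ 0 := by
      intro h; apply this; rw [← h]; ring
    rw [moebius_zero, moebius]
    push_cast
    rw [show (1 : ℂ) + a * -r = 1 - a * r by ring]
    field_simp
    ring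
  have h5 : 0 ≤ (1 - a ^ 2) * (r / (1 - a * r)) := by
    have : 0 ≤ 1 - a ^ 2 := by nlinarith
    positivity
  rw [h3, Complex.norm_real, norm_neg, Real.norm_of_nonneg h5]

theorem nonconstantOnDisk_moebius (h0 : 0 < a) (h1 : a < 1) : NonconstantOnDisk (moebius a) := by
  rintro ⟨c, hc⟩
  have h2 := norm_moebius_sub h0 h1 (r := 1 / 2) (by norm_num) (by norm_num)
  rw [hc 0 (by simp), hc _ (by simp; norm_num), sub_self, norm_zero] at h2
  have h3 : 0 < (1 - a ^ 2) * ((1 / 2) / (1 - a * (1 / 2))) := by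
    have h4 : 0 < 1 - a ^ 2 := by nlinarith
    have h5 : 0 < 1 - a * (1 / 2) := by linarith
    positivity
  linarith

theorem memHk_moebius (h0 : 0 < a) (h1 : a < 1) {k : ℝ} (hk : 0 ≤ k) :
    MemHk k (moebius a) (fun z => (k : ℂ) * (moebius a z - moebius a 0)) where
  memB := memB_moebius h0 h1
  analytic := ((memB_moebius h0 h1).analytic.sub_const _).const_mul _
  map_zero := by simp
  deriv_le := by
    intro z hz
    have hd := (memB_moebius h0 h1).analytic.differentiableAt (isOpen_ball.mem_nhds hz)
    rw [deriv_const_mul _ (hd.sub_const _), deriv_sub_const, norm_mul, Complex.norm_real,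
      Real.norm_of_nonneg hk]

end moebius

/-- Past the root of `lam` the inequality fails for some Möbius map. -/
theorem exists_one_lt_FFun {m : ℕ} {k p : ℝ} (hk : 0 ≤ k) (hp : 0 < p) {r : ℝ} (hr0 : 0 < r)
    (hr1 : r < 1) (hl : 0 < lam m k p r) : ∃ (h g : ℂ → ℂ) (z : ℂ),
      MemHk k h g ∧ NonconstantOnDisk h ∧ ‖z‖ = r ∧ 1 < FFun m k p h g z := by
  have hρ0 : 0 ≤ r ^ m := by positivity
  -- This expression is the desired inequality divided by 1 - a and cleared of denominators; at a =
  -- 1 it equals `lam`, so it stays positive for a near 1.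
  obtain ⟨a, ha, ha0, ha1⟩ : ∃ a : ℝ,
      0 < (1 + k) * (1 + a) * r * (a + r ^ m) - p * (1 - r ^ m) * (1 - a * r) ∧ 0 < a ∧ a < 1 := by
    have hc : Filter.Tendsto (fun a : ℝ => (1 + k) * (1 + a) * r * (a + r ^ m)
        - p * (1 - r ^ m) * (1 - a * r)) (nhdsWithin 1 (Iio 1)) (nhds (lam m k p r)) := by
      refine tendsto_nhdsWithin_of_tendsto_nhds ?_
      have : Continuous (fun a : ℝ => (1 + k) * (1 + a) * r * (a + r ^ m)
        - p * (1 - r ^ m) * (1 - a * r)) := by fun_prop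
      convert this.tendsto 1 using 2
      rw [lam]; ring
    obtain ⟨a, h1, h2⟩ := ((hc.eventually_const_lt hl).and (Ioo_mem_nhdsLT one_pos)).exists
    exact ⟨a, h1, h2.1, h2.2⟩
  refine ⟨moebius a, fun z => (k : ℂ) * (moebius a z - moebius a 0), r, memHk_moebius ha0 ha1 hk,
    nonconstantOnDisk_moebius ha0 ha1, by simp [abs_of_pos hr0], ?_⟩
  have hf := memHk_moebius ha0 ha1 hk
  have hnr : ‖(-r : ℂ)‖ = r := by simp [abs_of_pos hr0]
  have h2 : 0 < 1 - a * r := by nlinarith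
  -- At -r all nonconstant Taylor terms of the Möbius map have the same sign, so this lower bound
  -- for the majorant loses nothing. The square sums, of order (1 - a)², can be discarded.
  have hM1 := norm_sub_le_majorant hf.memB.analytic (z := -r) (by rw [hnr]; exact hr1)
  have hM2 := norm_sub_le_majorant hf.analytic (z := -r) (by rw [hnr]; exact hr1)
  rw [hnr, norm_moebius_sub ha0 ha1 hr0.le hr1] at hM1
  rw [hnr, ← mul_sub, sub_self, sub_zero, norm_mul, norm_moebius_sub ha0 ha1 hr0.le hr1,
    Complex.norm_real, Real.norm_of_nonneg hk] at hM2
  have hval : ‖moebius a ((r : ℂ) ^ m)‖ = (a + r ^ m) / (1 + a * r ^ m) := by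
    have : moebius a ((r : ℂ) ^ m) = (((a + r ^ m) / (1 + a * r ^ m) : ℝ) : ℂ) := by
      rw [moebius]; push_cast; rfl
    rw [this, Complex.norm_real, Real.norm_of_nonneg (by positivity)]
  have hnn : 0 ≤ 1 / (1 + ‖moebius a 0‖) * ((1 + ‖moebius a 0‖ * r) / (1 - r))
      * (normSqR (moebius a) r
        + cFun k * normSqR (fun z => (k : ℂ) * (moebius a z - moebius a 0)) r) := by
    have h3 : 0 < 1 - r := by linarith
    have h4 := normSqR_nonneg (moebius a) r
    have h5 := normSqR_nonneg (fun z => (k : ℂ) * (moebius a z - moebius a 0)) r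
    have h6 : 0 ≤ cFun k := by unfold cFun; split_ifs <;> positivity
    positivity
  rw [FFun, hval, EFun, Complex.norm_real, Real.norm_of_nonneg hr0.le]
  have hpw := one_sub_mul_div_le_rpow (t := (a + r ^ m) / (1 + a * r ^ m)) (by positivity) hp.le
  have hq : (1 - (a + r ^ m) / (1 + a * r ^ m)) / ((a + r ^ m) / (1 + a * r ^ m))
      = (1 - a) * ((1 - r ^ m) / (a + r ^ m)) := by
    field_simp; ring
  rw [hq] at hpw
  have hkey : p * ((1 - a) * ((1 - r ^ m) / (a + r ^ m)))
      < (1 + k) * ((1 - a ^ 2) * (r / (1 - a * r))) := by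
    have h7 : p * ((1 - r ^ m) / (a + r ^ m)) < (1 + k) * ((1 + a) * (r / (1 - a * r))) := by
      rw [mul_div_assoc', mul_div_assoc', mul_div_assoc', div_lt_div_iff₀ (by positivity) h2]
      linarith
    have h8 := mul_lt_mul_of_pos_left h7 (show 0 < 1 - a by linarith)
    linarith
  linarith

theorem corollary4 (m : ℕ) (k p : ℝ) (hm : 1 ≤ m) (hk0 : 0 ≤ k) (hk1 : k ≤ 1)
    (hp0 : 0 < p) (hp2 : p ≤ 2) :
    (∃! R : ℝ, R ∈ Ioo (0 : ℝ) 1 ∧ lam m k p R = 0) ∧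
    ∀ R : ℝ, R ∈ Ioo (0 : ℝ) 1 → lam m k p R = 0 →
      (∀ (h g : ℂ → ℂ) (q : ℕ), MemHk k h g → NonconstantOnDisk h →
        analyticOrderAt (fun z => h z - h 0) 0 = (q : ℕ∞) →
        (k ≠ 0 → ‖taylorCoeff g q‖ ≤ 1 / (2 * k * ‖taylorCoeff h q‖)) →
        ∀ z : ℂ, ‖z‖ ≤ R → FFun m k p h g z ≤ 1) ∧
      (k = 0 ∨ k = 1 ∨ p ≤ 1 ∨ (k ∈ Ioo (0 : ℝ) 1 ∧ p ∈ Ioc (1 : ℝ) 2 ∧ R ≤ 1 / 3) →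
        (∀ h g : ℂ → ℂ, MemHk k h g → NonconstantOnDisk h →
          ∀ z : ℂ, ‖z‖ ≤ R → FFun m k p h g z ≤ 1) ∧
        (∀ r : ℝ, r ∈ Ioo R 1 → ∃ (h g : ℂ → ℂ) (z : ℂ),
          MemHk k h g ∧ NonconstantOnDisk h ∧ ‖z‖ = r ∧ 1 < FFun m k p h g z)) := by
  refine ⟨existsUnique_lam_eq_zero hm hk0 hp0, fun R hR hR0 => ?_⟩
  have hmono := strictMonoOn_lam (m := m) hk0 hp0
  have hmain : ∀ h g : ℂ → ℂ, MemHk k h g → NonconstantOnDisk h →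
      ∀ z : ℂ, ‖z‖ ≤ R → FFun m k p h g z ≤ 1 := by
    intro h g hf hn z hz
    have hz1 : ‖z‖ < 1 := hz.trans_lt hR.2
    refine hf.FFun_le_one hm hk0 hp0 hp2 hn hz1 ?_
    rw [← hR0]
    exact hmono.monotoneOn ⟨norm_nonneg z, hz1.le⟩ (Ioo_subset_Icc_self hR) hz
  refine ⟨fun h g _ hf hn _ _ => hmain h g hf hn, fun _ => ⟨hmain, fun r hr => ?_⟩⟩
  have hr0 : 0 < r := hR.1.trans hr.1
  refine exists_one_lt_FFun hk0 hp0 hr0 hr.2 ?_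
  rw [← hR0]
  exact hmono (Ioo_subset_Icc_self hR) ⟨hr0.le, hr.2.le⟩ hr.1
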